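/- Let $0<q<1$ and $\alpha<0$. Write $(a;q)_n=\prod_{k=0}^{n-1}(1-aq^k)$, $(a;q)_\infty=\prod_{k\ge 0}(1-aq^k)$, $(a_1,\dots,a_r;q)_n=\prod_i (a_i;q)_n$ (also for $n=\infty$), and let $$\int_0^b f(x)\,d_qx=(1-q)\sum_{k\ge0}bq^kf(bq^k),\qquad \int_a^b f\,d_qx=\int_0^b f\,d_qx-\int_0^a f\,d_qx .$$ Let $U_n^{(\alpha)}(x;q)$ be the monic Al-Salam–Carlitz polynomials, $U_0^{(\alpha)}=1$, $U_1^{(\alpha)}=x-(\alpha+1)$, $xU_n^{(\alpha)}=U_{n+1}^{(\alpha)}+(\alpha+1)q^nU_n^{(\alpha)}-\alpha q^{n-1}(1-q^n)U_{n-1}^{(\alpha)}$ for $n\ge1$. The polynomials $U_n^{(\alpha)}(x;q^{1/2})$ are monic of degree $n$ and satisfy $$\int_\alpha^1U_m^{(\alpha)}(x;q^{1/2})U_n^{(\alpha)}(x;q^{1/2})\,(q^{1/2}x,q^{1/2}x/\alpha;q^{1/2})_\infty\,d_{q^{1/2}}x=\delta_{m,n}(-\alpha)^n(1-q^{1/2})q^{n(n-1)/4}(q^{1/2};q^{1/2})_n(\alpha,\alpha^{-1}q^{1/2},q^{1/2};q^{1/2})_\infty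 .$$ Let $\omega(x;q)=(-\alpha)^{-1/2}(qx,qx/\alpha;q)_\infty$ and $$\langle\phi,\psi\rangle_{1,\omega}=\int_\alpha^1\int_\alpha^{q^{1/2}y}\bigl(\phi(x)\psi(y)-\phi(y)\psi(x)\bigr)\omega(x;q)\omega(y;q)\,d_qx\,d_qy .$$ Let $(Q_n^{(\alpha)}(x;q))_{n\ge0}$ be real polynomials. Then the following are equivalent. 1. The $Q_n^{(\alpha)}$ are monic of degree $n$ and skew orthogonal, i.e. $\langle Q_{2m},Q_{2n}\rangle_{1,\omega}=\langle Q_{2m+1},Q_{2n+1}\rangle_{1,\omega}=0$ and $\langle Q_{2m},Q_{2n+1}\rangle_{1,\omega}=u_m\delta_{m,n}$ for some $u_m\neq0$, and are normalized so that, for every $n$, the coefficient of $U_{2n}^{(\alpha)}(x;q^{1/2})$ in the expansion of $Q_{2n+1}^{(\alpha)}$ in the $U_k^{(\alpha)}(x;q^{1/2})$ is $0$. 2. For all $n\ge0$ (where for $n=0$ the last term is absent), $$Q_{2n}^{(\alpha)}(x;q)=U_{2n}^{(\alpha)}(x;q^{1/2}),\qquad Q_{2n+1}^{(\alpha)}(x;q)=U_{2n+1}^{(\alpha)}(x;q^{1/2})+\alpha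 q^n(1-q^n)U_{2n-1}^{(\alpha)}(x;q^{1/2}).$$ 3. For all $n\ge0$, $$U_{2n}^{(\alpha)}(x;q^{1/2})=Q_{2n}^{(\alpha)}(x;q),\qquad U_{2n+1}^{(\alpha)}(x;q^{1/2})=\sum_{j=0}^nq^{\frac12(j+1+n)(n-j)}(-\alpha)^{n-j}(q^{j+1};q)_{n-j}\,Q_{2j+1}^{(\alpha)}(x;q).$$ Moreover, for every $n\ge0$, $$\int_{z_1=\alpha}^1\int_{z_2=\alpha}^{q^{1/2}z_1}\cdots\int_{z_{2n}=\alpha}^{q^{1/2}z_{2n-1}}\prod_{1\le j<k\le2n}(z_j-z_k)\prod_{i=1}^{2n}(qz_i,qz_i/\alpha;q)_\infty\,d_qz_{2n}\cdots d_qz_1$$ $$=(-\alpha)^{n^2}q^{\frac1{12}n(n-1)(4n+1)}(1-q)^{2n}\,(q^{1/2},\alpha,\alpha^{-1}q^{1/2};q^{1/2})_\infty^{\,n}\prod_{i=0}^{n-1}(q^{1/2};q^{1/2})_{2i}.$$ -/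

import Mathlib

namespace SkewQ

noncomputable section

/-- The finite `q`-shifted factorial `(a;q)_n = ∏_{k<n} (1 - a q^k)`. -/
def qPoch (a q : ℝ) (n : ℕ) : ℝ := ∏ k ∈ Finset.range n, (1 - a * q ^ k)

/-- The infinite `q`-shifted factorial `(a;q)_∞ = ∏_{k≥0} (1 - a q^k)`. -/
def qPochInf (a q : ℝ) : ℝ := ∏' k : ℕ, (1 - a * q ^ k)

/-- The Jackson integral `∫_0^b f(x) d_q x = (1 - q) ∑_{k≥0} b q^k f(b q^k)`
(`b` may be negative). -/
def jackson₀ (q b : ℝ) (f : ℝ → ℝ) : ℝ := (1 - q) * ∑' k : ℕ, b * q ^ k * f (b * q ^ k)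

/-- The Jackson integral `∫_a^b f(x) d_q x = ∫_0^b f(x) d_q x - ∫_0^a f(x) d_q x`. -/
def jackson (q a b : ℝ) (f : ℝ → ℝ) : ℝ := jackson₀ q b f - jackson₀ q a f

/-- The iterated Jackson integral
`∫_{z_1=a}^{b} ∫_{z_2=a}^{√q z_1} ⋯ ∫_{z_N=a}^{√q z_{N-1}} f(z_1,…,z_N) d_q z_N ⋯ d_q z_1`. -/
def iteratedJackson (q a : ℝ) : (N : ℕ) → ((Fin N → ℝ) → ℝ) → ℝ → ℝ
  | 0, f, _ => f Fin.elim0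
  | N + 1, f, b =>
      jackson q a b fun z =>
        iteratedJackson q a N (fun v => f (Fin.cons z v)) (Real.sqrt q * z)

/-- The monic Al-Salam–Carlitz polynomials `U_n^{(a)}(x;q)`:
`U_0 = 1`, `U_1 = x - (a + 1)` and
`x U_n = U_{n+1} + (a + 1) q^n U_n - a q^{n-1} (1 - q^n) U_{n-1}`. -/
def alSalamCarlitz (a q : ℝ) : ℕ → Polynomial ℝ
  | 0 => 1
  | 1 => Polynomial.X - Polynomial.C (a + 1)
  | n + 2 =>
      (Polynomial.X - Polynomial.C ((a + 1) * q ^ (n + 1))) * alSalamCarlitz a q (n + 1)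
        + Polynomial.C (a * q ^ n * (1 - q ^ (n + 1))) * alSalamCarlitz a q n

/-- The Al-Salam–Carlitz weight `ρ(x;q) = (q x;q)_∞ (q x/α;q)_∞`. -/
def rho (α q x : ℝ) : ℝ := qPochInf (q * x) q * qPochInf (q * x / α) q

/-- The skew weight `ω(x;q) = (-α)^{-1/2} (q x;q)_∞ (q x/α;q)_∞`. -/
def skewWeight (α q x : ℝ) : ℝ :=
  (-α) ^ (-(1 / 2) : ℝ) * (qPochInf (q * x) q * qPochInf (q * x / α) q)

/-- The skew inner product
`⟨φ,ψ⟩ = ∫_a^b ∫_a^{√q y} (φ(x) ψ(y) - φ(y) ψ(x)) ω(x) ω(y) d_q x d_q y`. -/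
def skewInner (q a b : ℝ) (ω : ℝ → ℝ) (φ ψ : Polynomial ℝ) : ℝ :=
  jackson q a b fun y => jackson q a (Real.sqrt q * y) fun x =>
    (φ.eval x * ψ.eval y - φ.eval y * ψ.eval x) * ω x * ω y

/-- `Q` is a family of monic skew orthogonal polynomials for the form `S`, with nonzero
normalization factors `u_m`. -/
structure IsSkewOrthogonal (S : Polynomial ℝ → Polynomial ℝ → ℝ) (Q : ℕ → Polynomial ℝ) :
    Prop where
  monic : ∀ n, (Q n).Monic
  natDegree_eq : ∀ n, (Q n).natDegree = n
  even_even : ∀ m n, S (Q (2 * m)) (Q (2 * n)) = 0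
  odd_odd : ∀ m n, S (Q (2 * m + 1)) (Q (2 * n + 1)) = 0
  even_odd : ∃ u : ℕ → ℝ, (∀ m, u m ≠ 0) ∧
    ∀ m n, S (Q (2 * m)) (Q (2 * n + 1)) = if m = n then u m else 0

/-- The choice of odd members, which are determined by skew orthogonality only up to adding
multiples of `Q_{2n}`: when `Q_{2n+1}` is expanded in the monic polynomials `p_0, p_1, …`,
the coefficient of `p_{2n}` is zero. -/
def OddNormalized (p Q : ℕ → Polynomial ℝ) : Prop :=
  ∀ n, Q (2 * n + 1) - p (2 * n + 1) ∈ Submodule.span ℝ (p '' Set.Iio (2 * n))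

end

end SkewQ

namespace SkewQ

open Filter Topology

/-! ### Shifted factorials -/

/-! Write `s` for the square root of `q`. The forward and backward shifts of the Al-Salam–Carlitz
polynomials of base `s` combine so that `skewShift α s n` times the base `s ^ 2` weight is an exact
`s ^ 2`-difference. Its primitive is explicit and vanishes at `α` and `1`. At the inner limit `s *
y` this primitive, multiplied by the outer weight, gives the base `s` weight, because the even and
odd powers of `s` interleave. After a summation by parts, skew pairing with `skewShift α s n` is
thus a multiple of ordinary pairing with `U_n` (`altInner_skewShift`).

Orthogonality of the `U_n` then gives the skew orthogonality of `U_{2n}` and `skewShift α s (2 *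
n)`. Uniqueness follows from nondegeneracy of the form on polynomials of degree below `2 * n`; the
normalization of the odd members keeps their difference in that space. The inverse relation is
back-substitution in a two-term recurrence.

For the multiple integral, the Vandermonde product is a determinant in the skew orthogonal
polynomials, that is, a top coefficient of a product of one-forms in an exterior algebra. A `q`-de
Bruijn formula (`iteratedJackson_prod_oneForm`) turns the iterated integral into a divided power of
a two-form. In the skew orthogonal basis that two-form is a sum of disjoint pairs, so its top
divided power is the product of the skew norms. -/

lemma summable_mul_geometric (a : ℝ) {q : ℝ} (hq0 : 0 < q) (hq1 : q < 1) :
    Summable fun k : ℕ => a * q ^ k :=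
  (summable_geometric_of_lt_one hq0.le hq1).mul_left a

lemma multipliable_one_sub_mul_pow (a : ℝ) {q : ℝ} (hq0 : 0 < q) (hq1 : q < 1) :
    Multipliable fun k : ℕ => 1 - a * q ^ k := by
  simpa [sub_eq_add_neg] using
    Real.multipliable_one_add_of_summable (summable_mul_geometric (-a) hq0 hq1)

lemma tendsto_qPoch (a : ℝ) {q : ℝ} (hq0 : 0 < q) (hq1 : q < 1) :
    Tendsto (qPoch a q) atTop (𝓝 (qPochInf a q)) :=
  (multipliable_one_sub_mul_pow a hq0 hq1).hasProd.tendsto_prod_nat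

@[simp] lemma qPoch_zero (a q : ℝ) : qPoch a q 0 = 1 := by simp [qPoch]

lemma qPoch_succ (a q : ℝ) (n : ℕ) : qPoch a q (n + 1) = qPoch a q n * (1 - a * q ^ n) := by
  simp [qPoch, Finset.prod_range_succ]

lemma qPoch_succ' (a q : ℝ) (n : ℕ) : qPoch a q (n + 1) = (1 - a) * qPoch (a * q) q n := by
  simp only [qPoch, Finset.prod_range_succ', pow_zero, mul_one]
  rw [mul_comm]
  congr 1
  exact Finset.prod_congr rfl fun k _ => by ring

lemma continuous_qPoch (q : ℝ) (n : ℕ) : Continuous fun a => qPoch a q n := by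
  unfold qPoch
  fun_prop

lemma qPochInf_eq (a : ℝ) {q : ℝ} (hq0 : 0 < q) (hq1 : q < 1) :
    qPochInf a q = (1 - a) * qPochInf (a * q) q := by
  refine tendsto_nhds_unique ((tendsto_qPoch a hq0 hq1).comp (tendsto_add_atTop_nat 1)) ?_
  refine ((tendsto_qPoch (a * q) hq0 hq1).const_mul (1 - a)).congr fun n => ?_
  simp [qPoch_succ']

lemma qPochInf_one {q : ℝ} (hq0 : 0 < q) (hq1 : q < 1) : qPochInf 1 q = 0 := by
  simp [qPochInf_eq 1 hq0 hq1]

lemma qPoch_two_mul (a q : ℝ) (n : ℕ) :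
    qPoch a q (2 * n) = qPoch a (q ^ 2) n * qPoch (a * q) (q ^ 2) n := by
  induction n with
  | zero => simp
  | succ n ih =>
    rw [show 2 * (n + 1) = 2 * n + 1 + 1 by ring, qPoch_succ, qPoch_succ, ih, qPoch_succ,
      qPoch_succ]
    ring

lemma qPochInf_split (a : ℝ) {q : ℝ} (hq0 : 0 < q) (hq1 : q < 1) :
    qPochInf a q = qPochInf a (q ^ 2) * qPochInf (a * q) (q ^ 2) := by
  have h0 : 0 < q ^ 2 := by positivity
  have h1 : q ^ 2 < 1 := by nlinarith
  refine tendsto_nhds_unique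
    ((tendsto_qPoch a hq0 hq1).comp (tendsto_id.const_mul_atTop' two_pos)) ?_
  refine ((tendsto_qPoch a h0 h1).mul (tendsto_qPoch (a * q) h0 h1)).congr fun n => ?_
  simp [qPoch_two_mul]

lemma abs_qPoch_le (a : ℝ) {q : ℝ} (hq0 : 0 < q) (hq1 : q < 1) (n : ℕ) :
    |qPoch a q n| ≤ Real.exp (|a| * (1 - q)⁻¹) := by
  have h1 : |qPoch a q n| ≤ ∏ k ∈ Finset.range n, (1 + |a| * q ^ k) := by
    rw [qPoch, Finset.abs_prod]
    refine Finset.prod_le_prod (fun _ _ => abs_nonneg _) fun k _ => ?_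
    refine (abs_sub _ _).trans ?_
    rw [abs_one, abs_mul, abs_of_pos (pow_pos hq0 k)]
  refine h1.trans ((Real.prod_one_add_le_exp_sum _ fun k => by positivity).trans ?_)
  rw [Real.exp_le_exp, ← Finset.mul_sum]
  refine mul_le_mul_of_nonneg_left ?_ (abs_nonneg a)
  rw [← tsum_geometric_of_lt_one hq0.le hq1]
  exact (summable_geometric_of_lt_one hq0.le hq1).sum_le_tsum _ fun k _ => by positivity

/-- The product converges uniformly on every ball. Continuity matters because telescoping Jackson
sums end in a limit at `0`. -/
lemma continuous_qPochInf {q : ℝ} (hq0 : 0 < q) (hq1 : q < 1) :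
    Continuous fun a => qPochInf a q := by
  rw [← continuousOn_univ]
  have key : ∀ R : ℝ, ContinuousOn (fun a => qPochInf a q) (Metric.closedBall 0 R) := by
    intro R
    have h := Summable.hasProdUniformlyOn_nat_one_add (f := fun (k : ℕ) (a : ℝ) => -(a * q ^ k))
      (isCompact_closedBall (0 : ℝ) R) (summable_mul_geometric R hq0 hq1)
      (Eventually.of_forall fun n x hx => by
        rw [norm_neg, norm_mul, Real.norm_of_nonneg (pow_pos hq0 n).le]
        exact mul_le_mul_of_nonneg_right (by simpa using hx) (pow_pos hq0 n).le)
      (fun n => by fun_prop)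
    have h2 := h.tendstoUniformlyOn_finsetRange.continuousOn
      (Frequently.of_forall fun n => by fun_prop)
    exact h2.congr fun x _ => by simp [qPochInf, sub_eq_add_neg]
  intro x _
  have hx : Metric.closedBall (0 : ℝ) (‖x‖ + 1) ∈ 𝓝 x :=
    Filter.mem_of_superset (Metric.ball_mem_nhds x one_pos) fun y hy => by
      have := norm_le_norm_add_norm_sub' y x
      simp only [Metric.mem_ball, dist_eq_norm] at hy
      simp only [Metric.mem_closedBall, dist_zero_right]
      linarith
  exact ((key _).continuousAt hx).continuousWithinAt

/-! ### Jackson integrals of continuous functions -/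

lemma exists_bound_of_continuous {f : ℝ → ℝ} (hf : Continuous f) (R : ℝ) :
    ∃ C, ∀ x, |x| ≤ R → |f x| ≤ C := by
  obtain ⟨C, hC⟩ := (isCompact_closedBall (0 : ℝ) R).exists_bound_of_continuousOn hf.continuousOn
  exact ⟨C, fun x hx => hC x (by simpa using hx)⟩

lemma abs_mul_pow_le {q : ℝ} (hq0 : 0 < q) (hq1 : q < 1) (b : ℝ) (k : ℕ) :
    |b * q ^ k| ≤ |b| := by
  rw [abs_mul, abs_of_pos (pow_pos hq0 k)]
  exact mul_le_of_le_one_right (abs_nonneg b) (pow_le_one₀ hq0.le hq1.le)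

lemma summable_jackson {q : ℝ} (hq0 : 0 < q) (hq1 : q < 1) {f : ℝ → ℝ} (hf : Continuous f)
    (b : ℝ) : Summable fun k : ℕ => b * q ^ k * f (b * q ^ k) := by
  obtain ⟨C, hC⟩ := exists_bound_of_continuous hf |b|
  refine Summable.of_norm_bounded (summable_mul_geometric (|b| * C) hq0 hq1) fun k => ?_
  rw [Real.norm_eq_abs, abs_mul, abs_mul, abs_of_pos (pow_pos hq0 k)]
  calc |b| * q ^ k * |f (b * q ^ k)| ≤ |b| * q ^ k * C :=
        mul_le_mul_of_nonneg_left (hC _ (abs_mul_pow_le hq0 hq1 b k))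
          (mul_nonneg (abs_nonneg b) (pow_pos hq0 k).le)
    _ = |b| * C * q ^ k := by ring

lemma continuous_jackson₀ {q : ℝ} (hq0 : 0 < q) (hq1 : q < 1) {f : ℝ → ℝ} (hf : Continuous f) :
    Continuous fun b => jackson₀ q b f := by
  unfold jackson₀
  refine continuous_const.mul ?_
  rw [← continuousOn_univ]
  have key : ∀ R : ℝ, ContinuousOn (fun b => ∑' k : ℕ, b * q ^ k * f (b * q ^ k))
      (Metric.closedBall 0 R) := by
    intro R
    obtain ⟨C, hC⟩ := exists_bound_of_continuous hf R
    refine continuousOn_tsum (fun k => by fun_prop) (summable_mul_geometric (R * C) hq0 hq1)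
      fun k b hb => ?_
    have hb' : |b| ≤ R := by simpa using hb
    have hfb := hC _ ((abs_mul_pow_le hq0 hq1 b k).trans hb')
    rw [Real.norm_eq_abs, abs_mul, abs_mul, abs_of_pos (pow_pos hq0 k)]
    calc |b| * q ^ k * |f (b * q ^ k)| ≤ R * q ^ k * C := by
          have := abs_nonneg (f (b * q ^ k))
          have := (abs_nonneg b).trans hb'
          have := pow_pos hq0 k
          gcongr
      _ = R * C * q ^ k := by ring
  intro x _
  have hx : Metric.closedBall (0 : ℝ) (‖x‖ + 1) ∈ 𝓝 x :=
    Filter.mem_of_superset (Metric.ball_mem_nhds x one_pos) fun y hy => by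
      have := norm_le_norm_add_norm_sub' y x
      simp only [Metric.mem_ball, dist_eq_norm] at hy
      simp only [Metric.mem_closedBall, dist_zero_right]
      linarith
  exact ((key _).continuousAt hx).continuousWithinAt

lemma continuous_jackson {q : ℝ} (hq0 : 0 < q) (hq1 : q < 1) {f : ℝ → ℝ} (hf : Continuous f)
    (a : ℝ) : Continuous fun b => jackson q a b f :=
  (continuous_jackson₀ hq0 hq1 hf).sub continuous_const

lemma jackson_self (q a : ℝ) (f : ℝ → ℝ) : jackson q a a f = 0 := sub_self _

lemma jackson₀_add {q : ℝ} (hq0 : 0 < q) (hq1 : q < 1) {f g : ℝ → ℝ} (hf : Continuous f)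
    (hg : Continuous g) (b : ℝ) :
    jackson₀ q b (fun x => f x + g x) = jackson₀ q b f + jackson₀ q b g := by
  rw [jackson₀, jackson₀, jackson₀, ← mul_add,
    ← (summable_jackson hq0 hq1 hf b).tsum_add (summable_jackson hq0 hq1 hg b)]
  simp only [mul_add]

lemma jackson_add {q : ℝ} (hq0 : 0 < q) (hq1 : q < 1) {f g : ℝ → ℝ} (hf : Continuous f)
    (hg : Continuous g) (a b : ℝ) :
    jackson q a b (fun x => f x + g x) = jackson q a b f + jackson q a b g := by
  rw [jackson, jackson₀_add hq0 hq1 hf hg, jackson₀_add hq0 hq1 hf hg, jackson, jackson]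
  ring

lemma jackson₀_const_mul (q b c : ℝ) (f : ℝ → ℝ) :
    jackson₀ q b (fun x => c * f x) = c * jackson₀ q b f := by
  rw [jackson₀, jackson₀, mul_left_comm c, ← tsum_mul_left (a := c)]
  congr 1
  exact tsum_congr fun k => by ring

lemma jackson_const_mul (q a b c : ℝ) (f : ℝ → ℝ) :
    jackson q a b (fun x => c * f x) = c * jackson q a b f := by
  rw [jackson, jackson₀_const_mul, jackson₀_const_mul, jackson, mul_sub]

lemma jackson_sub {q : ℝ} (hq0 : 0 < q) (hq1 : q < 1) {f g : ℝ → ℝ} (hf : Continuous f)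
    (hg : Continuous g) (a b : ℝ) :
    jackson q a b (fun x => f x - g x) = jackson q a b f - jackson q a b g := by
  have hg' : Continuous fun x => -1 * g x := by fun_prop
  have h := jackson_add hq0 hq1 hf hg' a b
  rw [jackson_const_mul] at h
  simpa [sub_eq_add_neg] using h

/-- The fundamental theorem of `q`-calculus. -/
lemma jackson_eq_sub {q : ℝ} (hq0 : 0 < q) (hq1 : q < 1) {g G : ℝ → ℝ} (hg : Continuous g)
    (hG : Continuous G) (h : ∀ x, G x - G (q * x) = (1 - q) * (x * g x)) (a b : ℝ) :
    jackson q a b g = G b - G a := by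
  have key : ∀ b, jackson₀ q b g = G b - G 0 := by
    intro b
    rw [jackson₀, ← tsum_mul_left]
    have hs := ((summable_jackson hq0 hq1 hg b).mul_left (1 - q)).hasSum.tendsto_sum_nat
    refine tendsto_nhds_unique hs ?_
    have h0 : Tendsto (fun n : ℕ => b * q ^ n) atTop (𝓝 0) := by
      simpa using (tendsto_pow_atTop_nhds_zero_of_lt_one hq0.le hq1).const_mul b
    refine (((hG.tendsto 0).comp h0).const_sub (G b)).congr fun n => ?_
    have : ∀ k, (1 - q) * (b * q ^ k * g (b * q ^ k)) = G (b * q ^ k) - G (b * q ^ (k + 1)) :=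
      fun k => by rw [← h, show b * q ^ (k + 1) = q * (b * q ^ k) by ring]
    simp only [this]
    rw [Finset.sum_range_sub']
    simp
  rw [jackson, key, key]
  ring

/-- The Jackson integral as a function of its upper limit. -/
lemma jackson_sub_jackson_mul {q : ℝ} (hq0 : 0 < q) (hq1 : q < 1) {f : ℝ → ℝ}
    (hf : Continuous f) (a b : ℝ) :
    jackson q a b f - jackson q a (q * b) f = (1 - q) * (b * f b) := by
  have h := (summable_jackson hq0 hq1 hf b).tsum_eq_zero_add
  have h2 : jackson₀ q b f - jackson₀ q (q * b) f = (1 - q) * (b * f b) := by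
    rw [jackson₀, jackson₀, h, ← mul_sub]
    have : ∀ k : ℕ, b * q ^ (k + 1) = q * b * q ^ k := fun k => by ring
    simp [this]
  rw [jackson, jackson, ← h2]
  ring

/-- A continuous function with vanishing `q`-difference is constant. -/
lemma eq_apply_zero_of_forall_eq_mul {q : ℝ} (hq0 : 0 < q) (hq1 : q < 1) {G : ℝ → ℝ}
    (hG : Continuous G) (h : ∀ x, G x = G (q * x)) (x : ℝ) : G x = G 0 := by
  have h1 := jackson_eq_sub hq0 hq1 (g := fun _ => 0) continuous_const hG
    (fun x => by simp [← h x]) 0 x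
  simp only [jackson, jackson₀, mul_zero, tsum_zero, sub_zero] at h1
  linarith

/-! ### The total mass of the Al-Salam–Carlitz weight -/

lemma continuous_rho (α : ℝ) {q : ℝ} (hq0 : 0 < q) (hq1 : q < 1) : Continuous (rho α q) := by
  unfold rho
  exact ((continuous_qPochInf hq0 hq1).comp (by fun_prop)).mul
    ((continuous_qPochInf hq0 hq1).comp (by fun_prop))

/-- The product `(x;q)_∞ (x/α;q)_∞`, which vanishes at `1` and at `α`. -/
noncomputable def rhoShift (α q x : ℝ) : ℝ := qPochInf x q * qPochInf (x / α) q

lemma continuous_rhoShift (α : ℝ) {q : ℝ} (hq0 : 0 < q) (hq1 : q < 1) :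
    Continuous (rhoShift α q) := by
  unfold rhoShift
  exact (continuous_qPochInf hq0 hq1).mul ((continuous_qPochInf hq0 hq1).comp (by fun_prop))

lemma rhoShift_mul (α q x : ℝ) : rhoShift α q (q * x) = rho α q x := rfl

lemma rhoShift_eq (α : ℝ) {q : ℝ} (hq0 : 0 < q) (hq1 : q < 1) (x : ℝ) :
    rhoShift α q x = (1 - x) * (1 - x / α) * rho α q x := by
  rw [rhoShift, rho, qPochInf_eq x hq0 hq1, qPochInf_eq (x / α) hq0 hq1, mul_comm x q,
    show x / α * q = q * x / α by ring]
  ring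

lemma rhoShift_one (α : ℝ) {q : ℝ} (hq0 : 0 < q) (hq1 : q < 1) : rhoShift α q 1 = 0 := by
  simp [rhoShift_eq α hq0 hq1]

lemma rhoShift_self {α : ℝ} (hα : α ≠ 0) {q : ℝ} (hq0 : 0 < q) (hq1 : q < 1) :
    rhoShift α q α = 0 := by
  simp [rhoShift_eq α hq0 hq1, div_self hα]

/-- Even powers of `s` come from one factor and odd powers from the other. This is where base `q ^
(1/2)` enters the problem. -/
lemma rhoShift_mul_rho_sq (α : ℝ) {s : ℝ} (hs0 : 0 < s) (hs1 : s < 1) (x : ℝ) :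
    rhoShift α (s ^ 2) (s * x) * rho α (s ^ 2) x = rho α s x := by
  rw [rhoShift, rho, rho, qPochInf_split (s * x) hs0 hs1, qPochInf_split (s * x / α) hs0 hs1,
    show s * x * s = s ^ 2 * x by ring, show s * x / α * s = s ^ 2 * x / α by ring]
  ring

/-- Truncating one infinite product makes the integral computable: consecutive truncations differ,
up to the stated ratio, by an exact `q`-difference. The total mass follows by letting `k` tend to
infinity. -/
lemma jackson_qPochInf_mul_qPoch {α : ℝ} (hα : α ≠ 0) {q : ℝ} (hq0 : 0 < q) (hq1 : q < 1)
    (k : ℕ) :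
    jackson q α 1 (fun x => qPochInf (q * x / α) q * qPoch (q * x) q k) =
      (1 - q) * ((1 - α) * qPochInf (α⁻¹ * q) q) * (qPoch (α * q) q k * qPoch q q k) := by
  have hc1 : Continuous fun x => qPochInf (x / α) q :=
    (continuous_qPochInf hq0 hq1).comp (by fun_prop)
  have hc2 : Continuous fun x => qPochInf (q * x / α) q :=
    (continuous_qPochInf hq0 hq1).comp (by fun_prop)
  have hc3 : ∀ k, Continuous fun x => qPoch (q * x) q k := fun k =>
    (continuous_qPoch q k).comp (by fun_prop)
  have hstep : ∀ x, qPochInf (x / α) q = (1 - x / α) * qPochInf (q * x / α) q := fun x => by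
    rw [qPochInf_eq (x / α) hq0 hq1, show x / α * q = q * x / α by ring]
  induction k with
  | zero =>
    simp only [qPoch_zero, mul_one]
    rw [jackson_eq_sub hq0 hq1 (G := fun x => -α * (1 - q) * qPochInf (x / α) q) hc2
      (continuous_const.mul hc1), div_self hα, qPochInf_one hq0 hq1,
      qPochInf_eq (1 / α) hq0 hq1, one_div]
    · field_simp
      ring
    · intro x
      rw [hstep x]
      field_simp
      ring
  | succ k ih =>
    have hT : jackson q α 1 (fun x =>
        qPochInf (q * x / α) q * qPoch (q * x) q (k + 1) -
          (1 - α * q ^ (k + 1)) * (1 - q ^ (k + 1)) *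
            (qPochInf (q * x / α) q * qPoch (q * x) q k)) = 0 := by
      have hc4 := continuous_qPoch q (k + 1)
      -- The primitive has no boundary terms: `(x/α;q)_∞` vanishes at `α` and `(x;q)_{k+1}` at `1`.
      rw [jackson_eq_sub hq0 hq1
        (G := fun x => -α * q ^ (k + 1) * (1 - q) * (qPochInf (x / α) q * qPoch x q (k + 1)))
        (by fun_prop) (by fun_prop), div_self hα,
        qPochInf_one hq0 hq1, qPoch_succ' 1]
      · ring
      · intro x
        rw [hstep x, qPoch_succ' x, qPoch_succ (q * x), mul_comm x q]
        field_simp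
        ring
    rw [jackson_sub hq0 hq1 (by fun_prop) (by fun_prop),
      jackson_const_mul, ih, sub_eq_zero] at hT
    rw [hT, qPoch_succ, qPoch_succ]
    ring

/-- Dominated convergence; the bound `abs_qPoch_le` does not depend on the length of the finite
product. -/
lemma tendsto_jackson₀_qPoch {q : ℝ} (hq0 : 0 < q) (hq1 : q < 1) {f : ℝ → ℝ}
    (hf : Continuous f) (b : ℝ) :
    Tendsto (fun k => jackson₀ q b fun x => f x * qPoch (q * x) q k) atTop
      (𝓝 (jackson₀ q b fun x => f x * qPochInf (q * x) q)) := by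
  obtain ⟨C, hC⟩ := exists_bound_of_continuous hf |b|
  have hC0 : 0 ≤ C := (abs_nonneg _).trans (hC b le_rfl)
  set D := Real.exp (|b| * (1 - q)⁻¹) with hD
  refine Tendsto.const_mul _ (tendsto_tsum_of_dominated_convergence
    (summable_mul_geometric (|b| * (C * D)) hq0 hq1) (fun i => ?_)
    (Eventually.of_forall fun k i => ?_))
  · exact ((tendsto_qPoch _ hq0 hq1).const_mul _).const_mul _
  · have h1 := hC _ (abs_mul_pow_le hq0 hq1 b i)
    have h2 : |qPoch (q * (b * q ^ i)) q k| ≤ D := by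
      refine (abs_qPoch_le _ hq0 hq1 k).trans (Real.exp_le_exp.2 ?_)
      refine mul_le_mul_of_nonneg_right ?_ (inv_nonneg.2 (by linarith))
      rw [abs_mul, abs_of_pos hq0]
      exact (mul_le_of_le_one_left (abs_nonneg _) hq1.le).trans (abs_mul_pow_le hq0 hq1 b i)
    rw [Real.norm_eq_abs, abs_mul, abs_mul, abs_mul, abs_of_pos (pow_pos hq0 i)]
    have := pow_pos hq0 i
    calc |b| * q ^ i * (|f (b * q ^ i)| * |qPoch (q * (b * q ^ i)) q k|)
        ≤ |b| * q ^ i * (C * D) := by gcongr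
      _ = |b| * (C * D) * q ^ i := by ring

theorem jackson_rho {α : ℝ} (hα : α ≠ 0) {q : ℝ} (hq0 : 0 < q) (hq1 : q < 1) :
    jackson q α 1 (rho α q) =
      (1 - q) * (qPochInf α q * qPochInf (α⁻¹ * q) q * qPochInf q q) := by
  have hc : Continuous fun x => qPochInf (q * x / α) q :=
    (continuous_qPochInf hq0 hq1).comp (by fun_prop)
  have h1 := (tendsto_jackson₀_qPoch hq0 hq1 hc 1).sub (tendsto_jackson₀_qPoch hq0 hq1 hc α)
  have h2 : Tendsto (fun k => (1 - q) * ((1 - α) * qPochInf (α⁻¹ * q) q) *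
      (qPoch (α * q) q k * qPoch q q k)) atTop (𝓝 ((1 - q) * ((1 - α) * qPochInf (α⁻¹ * q) q) *
      (qPochInf (α * q) q * qPochInf q q))) :=
    ((tendsto_qPoch _ hq0 hq1).mul (tendsto_qPoch _ hq0 hq1)).const_mul _
  have h3 := tendsto_nhds_unique
    (h2.congr fun k => (jackson_qPochInf_mul_qPoch hα hq0 hq1 k).symm) h1
  have h4 : rho α q = fun x => qPochInf (q * x / α) q * qPochInf (q * x) q :=
    funext fun x => mul_comm _ _
  rw [h4, jackson, ← h3, qPochInf_eq α hq0 hq1]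
  ring

/-! ### Al-Salam–Carlitz polynomials -/

/-- Uniform in `n`: at `n = 0` the truncated index `n - 1` is harmless, since `1 - s ^ 0 = 0`. -/
lemma alSalamCarlitz_succ (a s : ℝ) (n : ℕ) :
    alSalamCarlitz a s (n + 1) =
      (Polynomial.X - Polynomial.C ((a + 1) * s ^ n)) * alSalamCarlitz a s n +
        Polynomial.C (a * s ^ (n - 1) * (1 - s ^ n)) * alSalamCarlitz a s (n - 1) := by
  cases n with
  | zero => simp [alSalamCarlitz]
  | succ n => rw [alSalamCarlitz]; rfl

lemma alSalamCarlitz_monic_natDegree (a s : ℝ) (n : ℕ) :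
    (alSalamCarlitz a s n).Monic ∧ (alSalamCarlitz a s n).natDegree = n := by
  induction n using Nat.strong_induction_on with
  | _ n ih =>
    match n with
    | 0 => simp [alSalamCarlitz]
    | 1 => exact ⟨Polynomial.monic_X_sub_C _, Polynomial.natDegree_X_sub_C _⟩
    | n + 2 =>
      obtain ⟨hm1, hd1⟩ := ih (n + 1) (by omega)
      obtain ⟨hm0, hd0⟩ := ih n (by omega)
      rw [alSalamCarlitz]
      have hm := (Polynomial.monic_X_sub_C ((a + 1) * s ^ (n + 1))).mul hm1
      have hd : ((Polynomial.X - Polynomial.C ((a + 1) * s ^ (n + 1))) *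
          alSalamCarlitz a s (n + 1)).natDegree = n + 2 := by
        rw [(Polynomial.monic_X_sub_C _).natDegree_mul hm1, Polynomial.natDegree_X_sub_C, hd1]
        ring
      have hlt : (Polynomial.C (a * s ^ n * (1 - s ^ (n + 1))) * alSalamCarlitz a s n).degree <
          ((Polynomial.X - Polynomial.C ((a + 1) * s ^ (n + 1))) *
          alSalamCarlitz a s (n + 1)).degree := by
        rw [Polynomial.degree_eq_natDegree hm.ne_zero, hd]
        refine lt_of_le_of_lt (Polynomial.degree_le_of_natDegree_le
          ((Polynomial.natDegree_C_mul_le _ _).trans hd0.le)) ?_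
        exact_mod_cast (by omega : n < n + 2)
      exact ⟨hm.add_of_left hlt, by rw [Polynomial.natDegree_add_eq_left_of_degree_lt hlt, hd]⟩

/-- The forward shift. -/
lemma alSalamCarlitz_eval_sub (a s : ℝ) (n : ℕ) (x : ℝ) :
    (alSalamCarlitz a s n).eval x - (alSalamCarlitz a s n).eval (s * x) =
      (1 - s ^ n) * (x * (alSalamCarlitz a s (n - 1)).eval x) := by
  induction n using Nat.strong_induction_on with
  | _ n ih =>
    match n with
    | 0 => simp [alSalamCarlitz]
    | 1 => simp [alSalamCarlitz]; ring
    | n + 2 =>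
      have h1 := ih (n + 1) (by omega)
      have h0 := ih n (by omega)
      have hr := congrArg (Polynomial.eval x) (alSalamCarlitz_succ a s n)
      rw [alSalamCarlitz]
      simp only [Polynomial.eval_add, Polynomial.eval_mul, Polynomial.eval_sub, Polynomial.eval_X,
        Polynomial.eval_C, Nat.add_sub_cancel] at h1 hr ⊢
      rw [show n + 2 - 1 = n + 1 by omega]
      -- Moves a power of `s` across the truncated exponent `n - 1`; for `n = 0` both sides vanish.
      have hd : a * s ^ n * (1 - s ^ n) = s * (a * s ^ (n - 1) * (1 - s ^ n)) := by
        cases n with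
        | zero => simp
        | succ n => rw [Nat.add_sub_cancel, pow_succ s n]; ring
      set d := a * s ^ (n - 1) * (1 - s ^ n)
      linear_combination (s * x - (a + 1) * s ^ (n + 1)) * h1 +
        a * s ^ n * (1 - s ^ (n + 1)) * h0 - s * (1 - s ^ (n + 1)) * x * hr +
        (1 - s ^ (n + 1)) * x * (alSalamCarlitz a s (n - 1)).eval x * hd

/-- The backward shift. -/
lemma alSalamCarlitz_eval_div_sub {a s : ℝ} (ha : a ≠ 0) (hs : s ≠ 0) (n : ℕ) (x : ℝ) :
    a * s ^ n * ((1 - x) * (1 - x / a) * (alSalamCarlitz a s n).eval (x / s) -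
      (alSalamCarlitz a s n).eval x) = x * (alSalamCarlitz a s (n + 1)).eval x := by
  obtain ⟨y, rfl⟩ : ∃ y, x = s * y := ⟨x / s, by field_simp⟩
  rw [mul_div_cancel_left₀ _ hs]
  have h1 := alSalamCarlitz_eval_sub a s (n + 1) y
  have h0 := alSalamCarlitz_eval_sub a s n y
  have hr := congrArg (Polynomial.eval y) (alSalamCarlitz_succ a s n)
  simp only [Polynomial.eval_add, Polynomial.eval_mul, Polynomial.eval_sub, Polynomial.eval_X,
    Polynomial.eval_C, Nat.add_sub_cancel] at h1 hr
  have hd : a * s ^ n * (1 - s ^ n) = s * (a * s ^ (n - 1) * (1 - s ^ n)) := by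
    cases n with
    | zero => simp
    | succ n => rw [Nat.add_sub_cancel, pow_succ s n]; ring
  have hx : a * ((1 - s * y) * (1 - s * y / a)) = (1 - s * y) * (a - s * y) := by
    field_simp
  set d := a * s ^ (n - 1) * (1 - s ^ n)
  linear_combination s ^ n * (alSalamCarlitz a s n).eval y * hx + a * s ^ n * h0 +
    s * y * h1 - s * y * hr + y * (alSalamCarlitz a s (n - 1)).eval y * hd

/-- The inner product for which the Al-Salam–Carlitz polynomials are orthogonal. -/
noncomputable def ascInner (α s : ℝ) (φ ψ : Polynomial ℝ) : ℝ :=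
  jackson s α 1 fun x => φ.eval x * ψ.eval x * rho α s x

lemma ascInner_comm (α s : ℝ) (φ ψ : Polynomial ℝ) : ascInner α s φ ψ = ascInner α s ψ φ := by
  simp only [ascInner, mul_comm (φ.eval _)]

/-- The backward shift on one argument is adjoint to the forward shift on the other. The primitive
contains `rhoShift`, so summation by parts leaves no boundary terms. -/
lemma ascInner_alSalamCarlitz_succ {α s : ℝ} (hα : α ≠ 0) (hs0 : 0 < s) (hs1 : s < 1)
    (m n : ℕ) :
    ascInner α s (alSalamCarlitz α s m) (alSalamCarlitz α s (n + 1)) =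
      -α * s ^ n * (1 - s ^ m) *
        ascInner α s (alSalamCarlitz α s (m - 1)) (alSalamCarlitz α s n) := by
  have hρ := continuous_rho α hs0 hs1
  have hW := continuous_rhoShift α hs0 hs1
  have key : jackson s α 1 (fun x =>
      (alSalamCarlitz α s m).eval x * (alSalamCarlitz α s (n + 1)).eval x * rho α s x -
      -α * s ^ n * (1 - s ^ m) *
        ((alSalamCarlitz α s (m - 1)).eval x * (alSalamCarlitz α s n).eval x * rho α s x)) =
      0 := by
    rw [jackson_eq_sub hs0 hs1 (G := fun x => (1 - s) * α * s ^ n *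
      ((alSalamCarlitz α s n).eval (x / s) * rhoShift α s x * (alSalamCarlitz α s m).eval x))
      (by fun_prop) (by fun_prop), rhoShift_one α hs0 hs1, rhoShift_self hα hs0 hs1]
    · ring
    · intro x
      rw [rhoShift_mul, mul_div_cancel_left₀ _ hs0.ne', rhoShift_eq α hs0 hs1 x]
      have h1 := alSalamCarlitz_eval_div_sub hα hs0.ne' n x
      have h2 := alSalamCarlitz_eval_sub α s m x
      linear_combination (1 - s) * rho α s x * (alSalamCarlitz α s m).eval x * h1 +
        (1 - s) * α * s ^ n * rho α s x * (alSalamCarlitz α s n).eval x * h2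
  rw [jackson_sub hs0 hs1 (by fun_prop) (by fun_prop), jackson_const_mul,
    sub_eq_zero] at key
  exact key

/-- Lowering both indices together ends at the total mass if `m = n`, and otherwise meets the factor
`1 - s ^ 0`. -/
theorem ascInner_alSalamCarlitz {α s : ℝ} (hα : α ≠ 0) (hs0 : 0 < s) (hs1 : s < 1) (m n : ℕ) :
    ascInner α s (alSalamCarlitz α s m) (alSalamCarlitz α s n) =
      if m = n then (-α) ^ n * (1 - s) * s ^ (n.choose 2) * qPoch s s n *
        (qPochInf α s * qPochInf (α⁻¹ * s) s * qPochInf s s) else 0 := by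
  induction n generalizing m with
  | zero =>
    cases m with
    | zero =>
      have := jackson_rho hα hs0 hs1
      simpa [ascInner, alSalamCarlitz] using this
    | succ m =>
      rw [ascInner_comm, ascInner_alSalamCarlitz_succ hα hs0 hs1]
      simp
  | succ n ih =>
    rw [ascInner_alSalamCarlitz_succ hα hs0 hs1]
    cases m with
    | zero => simp
    | succ m =>
      rw [Nat.add_sub_cancel, ih, Nat.choose_succ_succ' n 1, Nat.choose_one_right, qPoch_succ]
      simp only [Nat.add_right_cancel_iff]
      split_ifs with h
      · subst h
        ring
      · ring

/-! ### The skew inner product -/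

/-- The unnormalized skew inner product
`∫_α^1 (ψ(y) ρ(y) ∫_α^{sy} φ ρ - φ(y) ρ(y) ∫_α^{sy} ψ ρ) d_q y` with `q = s ^ 2`. -/
noncomputable def altInner (α s : ℝ) (φ ψ : Polynomial ℝ) : ℝ :=
  jackson (s ^ 2) α 1 fun y =>
    ψ.eval y * rho α (s ^ 2) y *
        jackson (s ^ 2) α (s * y) (fun x => φ.eval x * rho α (s ^ 2) x) -
      φ.eval y * rho α (s ^ 2) y *
        jackson (s ^ 2) α (s * y) (fun x => ψ.eval x * rho α (s ^ 2) x)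

section

variable {α s : ℝ}

lemma sq_pos_of_base (hs0 : 0 < s) : 0 < s ^ 2 := pow_pos hs0 2

lemma sq_lt_one_of_base (hs0 : 0 < s) (hs1 : s < 1) : s ^ 2 < 1 :=
  pow_lt_one₀ hs0.le hs1 two_ne_zero

lemma continuous_eval_mul_rho (hs0 : 0 < s) (hs1 : s < 1) (φ : Polynomial ℝ) :
    Continuous fun x => φ.eval x * rho α (s ^ 2) x :=
  φ.continuous.mul (continuous_rho α (sq_pos_of_base hs0) (sq_lt_one_of_base hs0 hs1))

lemma continuous_jackson_eval (hs0 : 0 < s) (hs1 : s < 1) (φ : Polynomial ℝ) :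
    Continuous fun y => jackson (s ^ 2) α y (fun x => φ.eval x * rho α (s ^ 2) x) :=
  continuous_jackson (sq_pos_of_base hs0) (sq_lt_one_of_base hs0 hs1)
    (continuous_eval_mul_rho hs0 hs1 φ) α

lemma continuous_jackson_eval_mul (hs0 : 0 < s) (hs1 : s < 1) (φ : Polynomial ℝ) :
    Continuous fun y => jackson (s ^ 2) α (s * y) (fun x => φ.eval x * rho α (s ^ 2) x) :=
  (continuous_jackson_eval hs0 hs1 φ).comp (by fun_prop)

lemma skewInner_eq_altInner (hα : α < 0) (hs0 : 0 < s) (hs1 : s < 1) (φ ψ : Polynomial ℝ) :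
    skewInner (s ^ 2) α 1 (skewWeight α (s ^ 2)) φ ψ = (-α)⁻¹ * altInner α s φ ψ := by
  have hq0 := sq_pos_of_base hs0
  have hq1 := sq_lt_one_of_base hs0 hs1
  have hφ := continuous_eval_mul_rho (α := α) hs0 hs1 φ
  have hψ := continuous_eval_mul_rho (α := α) hs0 hs1 ψ
  have hc : (-α) ^ (-(1 / 2) : ℝ) * (-α) ^ (-(1 / 2) : ℝ) = (-α)⁻¹ := by
    rw [← Real.rpow_add (by linarith), ← Real.rpow_neg_one]
    norm_num
  rw [skewInner, altInner, ← jackson_const_mul, Real.sqrt_sq hs0.le]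
  congr 1
  funext y
  rw [← jackson_const_mul, ← jackson_const_mul,
    ← jackson_sub hq0 hq1 (by fun_prop) (by fun_prop), ← jackson_const_mul]
  congr 1
  funext x
  change _ * ((-α) ^ (-(1 / 2) : ℝ) * rho α (s ^ 2) x) *
    ((-α) ^ (-(1 / 2) : ℝ) * rho α (s ^ 2) y) = _
  rw [← hc]
  ring

lemma altInner_neg_swap (α s : ℝ) (φ ψ : Polynomial ℝ) :
    altInner α s φ ψ = -altInner α s ψ φ := by
  rw [altInner, altInner, ← neg_one_mul, ← jackson_const_mul]
  congr 1
  funext y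
  ring

lemma altInner_add_right (hs0 : 0 < s) (hs1 : s < 1) (φ ψ χ : Polynomial ℝ) :
    altInner α s φ (ψ + χ) = altInner α s φ ψ + altInner α s φ χ := by
  have hq0 := sq_pos_of_base hs0
  have hq1 := sq_lt_one_of_base hs0 hs1
  have hρ := continuous_rho α hq0 hq1
  have h1 := continuous_jackson_eval_mul (α := α) hs0 hs1 φ
  have h2 := continuous_jackson_eval_mul (α := α) hs0 hs1 ψ
  have h3 := continuous_jackson_eval_mul (α := α) hs0 hs1 χ
  rw [altInner, altInner, altInner, ← jackson_add hq0 hq1 (by fun_prop) (by fun_prop)]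
  congr 1
  funext y
  simp only [Polynomial.eval_add, add_mul]
  rw [jackson_add hq0 hq1 (by fun_prop) (by fun_prop)]
  ring

lemma altInner_smul_right (α s c : ℝ) (φ ψ : Polynomial ℝ) :
    altInner α s φ (c • ψ) = c * altInner α s φ ψ := by
  rw [altInner, altInner, ← jackson_const_mul]
  congr 1
  funext y
  simp only [Polynomial.eval_smul, smul_eq_mul, mul_assoc c]
  rw [jackson_const_mul]
  ring

/-- `altInner` as a bilinear form. -/
noncomputable def altForm (α : ℝ) (hs0 : 0 < s) (hs1 : s < 1) :
    Polynomial ℝ →ₗ[ℝ] Polynomial ℝ →ₗ[ℝ] ℝ :=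
  LinearMap.mk₂ ℝ (altInner α s)
    (fun φ ψ χ => by
      rw [altInner_neg_swap, altInner_add_right hs0 hs1, altInner_neg_swap α s φ,
        altInner_neg_swap α s ψ, neg_add])
    (fun c φ ψ => by
      rw [altInner_neg_swap, altInner_smul_right, altInner_neg_swap α s φ, smul_eq_mul, mul_neg])
    (fun φ ψ χ => altInner_add_right hs0 hs1 φ ψ χ)
    (fun c φ ψ => altInner_smul_right α s c φ ψ)

lemma altForm_apply (hs0 : 0 < s) (hs1 : s < 1) (φ ψ : Polynomial ℝ) :
    altForm α hs0 hs1 φ ψ = altInner α s φ ψ := rfl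

/-- The polynomials `U_{n+1} + α s^n (1 - s^n) U_{n-1}`, images of `U_n` under the operator
relating the skew inner product to the inner product. -/
noncomputable def skewShift (α s : ℝ) (n : ℕ) : Polynomial ℝ :=
  alSalamCarlitz α s (n + 1) + Polynomial.C (α * s ^ n * (1 - s ^ n)) * alSalamCarlitz α s (n - 1)

/-- Adding the two shift relations cancels the value at `x`. The remaining arguments `x / s` and `s
* x` differ by the factor `s ^ 2`, as a base `s ^ 2` difference requires. -/
lemma mul_eval_skewShift (hα : α ≠ 0) (hs : s ≠ 0) (n : ℕ) (x : ℝ) :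
    x * (skewShift α s n).eval x =
      α * s ^ n * ((1 - x) * (1 - x / α) * (alSalamCarlitz α s n).eval (x / s) -
        (alSalamCarlitz α s n).eval (s * x)) := by
  have h1 := alSalamCarlitz_eval_div_sub hα hs n x
  have h2 := alSalamCarlitz_eval_sub α s n x
  simp only [skewShift, Polynomial.eval_add, Polynomial.eval_mul, Polynomial.eval_C]
  linear_combination -h1 - α * s ^ n * h2

/-- The inner integral of `skewShift α s n` is the explicit function `h`. The term containing it
sums over the points `b * s ^ (2 * k)`; summation by parts in the other term supplies the odd powers
of `s`. Together they form the base `s` Jackson integral. -/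
lemma altInner_skewShift (hα : α ≠ 0) (hs0 : 0 < s) (hs1 : s < 1) (φ : Polynomial ℝ) (n : ℕ) :
    altInner α s φ (skewShift α s n) =
      -α * (1 - s ^ 2) * (1 + s) * s ^ n * ascInner α s φ (alSalamCarlitz α s n) := by
  have hq0 := sq_pos_of_base hs0
  have hq1 := sq_lt_one_of_base hs0 hs1
  have hρ := continuous_rho α hq0 hq1
  have hρs := continuous_rho α hs0 hs1
  have hW := continuous_rhoShift α hq0 hq1
  have hΦ := continuous_jackson_eval_mul (α := α) hs0 hs1 φ
  set U := alSalamCarlitz α s n with hU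
  set h : ℝ → ℝ := fun x => (1 - s ^ 2) * α * s ^ n * (U.eval (x / s) * rhoShift α (s ^ 2) x)
    with hh
  have hhc : Continuous h := by fun_prop
  have hh1 : h 1 = 0 := by simp [hh, rhoShift_one α hq0 hq1]
  have hhα : h α = 0 := by simp [hh, rhoShift_self hα hq0 hq1]
  have hdiff : ∀ x, h x - h (s ^ 2 * x) =
      (1 - s ^ 2) * (x * ((skewShift α s n).eval x * rho α (s ^ 2) x)) := by
    intro x
    have h1 := mul_eval_skewShift hα hs0.ne' n x
    rw [hh]
    simp only
    rw [rhoShift_mul, show s ^ 2 * x / s = s * x by field_simp, rhoShift_eq α hq0 hq1 x]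
    linear_combination -(1 - s ^ 2) * rho α (s ^ 2) x * h1
  have hint : ∀ u, jackson (s ^ 2) α u
      (fun x => (skewShift α s n).eval x * rho α (s ^ 2) x) = h u := fun u => by
    rw [jackson_eq_sub hq0 hq1 (by fun_prop) hhc hdiff, hhα, sub_zero]
  have hNc : Continuous fun x => φ.eval x * U.eval x * rho α s x := by fun_prop
  set N : ℝ → ℝ := fun b => jackson s α b fun x => φ.eval x * U.eval x * rho α s x with hN
  have hNcont : Continuous N := continuous_jackson hs0 hs1 hNc α
  have hNdiff : ∀ b, N b - N (s * b) = (1 - s) * (b * (φ.eval b * U.eval b * rho α s b)) :=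
    fun b => jackson_sub_jackson_mul hs0 hs1 hNc α b
  have hΦdiff := fun b => jackson_sub_jackson_mul hq0 hq1
    (continuous_eval_mul_rho (α := α) hs0 hs1 φ) α b
  -- The weights merge by `rhoShift_mul_rho_sq`; the factor `1 + s` is `(1 - s ^ 2) / (1 - s)`, from
  -- the change of base.
  have hhs : ∀ b, h (s * b) * ((1 - s ^ 2) * (b * (φ.eval b * rho α (s ^ 2) b))) =
      (1 - s ^ 2) * (1 + s) * α * s ^ n * (N b - N (s * b)) := by
    intro b
    rw [hNdiff, hh, ← rhoShift_mul_rho_sq α hs0 hs1]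
    simp only
    rw [mul_div_cancel_left₀ _ hs0.ne']
    ring
  simp only [altInner, hint]
  -- The first term of `G` performs the summation by parts and vanishes at both endpoints; only `N
  -- 1` survives.
  rw [jackson_eq_sub hq0 hq1
    (G := fun b => h b * jackson (s ^ 2) α (s * b) (fun x => φ.eval x * rho α (s ^ 2) x) -
      (1 - s ^ 2) * (1 + s) * α * s ^ n * N b) (by fun_prop) (by fun_prop), hh1, hhα,
    show N α = 0 from jackson_self s α _, ascInner]
  · ring
  · intro b
    have e1 := hhs b
    have e2 := hhs (s * b)
    have e3 := hΦdiff (s * b)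
    have e4 := hdiff b
    rw [show s * (s * b) = s ^ 2 * b by ring] at e2
    rw [show s ^ 2 * (s * b) = s * (s ^ 2 * b) by ring] at e3
    linear_combination jackson (s ^ 2) α (s * b) (fun x => φ.eval x * rho α (s ^ 2) x) * e4 +
      h (s ^ 2 * b) * e3 + e1 + e2

/-- The skew norms of the Al-Salam–Carlitz weight. -/
noncomputable def altNorm (α s : ℝ) (m : ℕ) : ℝ :=
  (-α) ^ (2 * m + 1) * (1 - s ^ 2) ^ 2 * s ^ (m * (2 * m + 1)) * qPoch s s (2 * m) *
    (qPochInf α s * qPochInf (α⁻¹ * s) s * qPochInf s s)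

lemma altInner_alSalamCarlitz_skewShift (hα : α ≠ 0) (hs0 : 0 < s) (hs1 : s < 1) (m n : ℕ) :
    altInner α s (alSalamCarlitz α s (2 * m)) (skewShift α s (2 * n)) =
      if m = n then altNorm α s m else 0 := by
  rw [altInner_skewShift hα hs0 hs1, ascInner_alSalamCarlitz hα hs0 hs1]
  by_cases h : m = n
  · subst h
    have : (2 * m).choose 2 + 2 * m = m * (2 * m + 1) := by
      have h2 : (2 * m).choose 2 = m * (2 * m - 1) := by
        rw [Nat.choose_two_right, mul_assoc, Nat.mul_div_cancel_left _ two_pos]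
      rw [h2]
      cases m with
      | zero => rfl
      | succ m => rw [show 2 * (m + 1) - 1 = 2 * m + 1 by omega]; ring
    rw [if_pos rfl, if_pos rfl, altNorm, ← this, pow_add s]
    ring
  · rw [if_neg h, if_neg (by omega)]
    ring

/-- Parity: the first argument is a combination of `U_k` with `k` odd, orthogonal to `U_{2n}`. -/
lemma altInner_skewShift_skewShift (hα : α ≠ 0) (hs0 : 0 < s) (hs1 : s < 1) (m n : ℕ) :
    altInner α s (skewShift α s (2 * m)) (skewShift α s (2 * n)) = 0 := by
  rw [← altForm_apply hs0 hs1, skewShift, ← Polynomial.smul_eq_C_mul, map_add,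
    map_smul, LinearMap.add_apply, LinearMap.smul_apply, altForm_apply, altForm_apply,
    altInner_skewShift hα hs0 hs1, altInner_skewShift hα hs0 hs1,
    ascInner_alSalamCarlitz hα hs0 hs1, ascInner_alSalamCarlitz hα hs0 hs1]
  cases m with
  | zero => rw [if_neg (by omega)]; simp
  | succ m => rw [if_neg (by omega), if_neg (by omega)]; simp

lemma altInner_self (α s : ℝ) (φ : Polynomial ℝ) : altInner α s φ φ = 0 := by
  have := altInner_neg_swap α s φ φ
  linarith

/-- Pairing with the odd-indexed `skewShift α s (2 * n + 1)`, a combination of `U_{2n+2}` and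
`U_{2n}`, gives zero because `U_{2m}` is orthogonal to `U_{2n+1}`. -/
lemma altInner_alSalamCarlitz_even_succ (hα : α ≠ 0) (hs0 : 0 < s) (hs1 : s < 1) (m n : ℕ) :
    altInner α s (alSalamCarlitz α s (2 * m)) (alSalamCarlitz α s (2 * (n + 1))) =
      -(α * s ^ (2 * n + 1) * (1 - s ^ (2 * n + 1))) *
        altInner α s (alSalamCarlitz α s (2 * m)) (alSalamCarlitz α s (2 * n)) := by
  have h := altInner_skewShift hα hs0 hs1 (alSalamCarlitz α s (2 * m)) (2 * n + 1)
  rw [ascInner_alSalamCarlitz hα hs0 hs1, if_neg (by omega), mul_zero,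
    ← altForm_apply hs0 hs1, skewShift, ← Polynomial.smul_eq_C_mul, map_add, map_smul,
    altForm_apply, altForm_apply, Nat.add_sub_cancel] at h
  rw [show 2 * (n + 1) = 2 * n + 1 + 1 by ring]
  simp only [smul_eq_mul] at h
  linarith

/-- The recurrence lowers one index to `0`, antisymmetry lets it lower the other, and the pairing of
`U_0` with itself is zero. -/
lemma altInner_alSalamCarlitz_even (hα : α ≠ 0) (hs0 : 0 < s) (hs1 : s < 1) (m n : ℕ) :
    altInner α s (alSalamCarlitz α s (2 * m)) (alSalamCarlitz α s (2 * n)) = 0 := by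
  have h0 : ∀ m, altInner α s (alSalamCarlitz α s (2 * m)) (alSalamCarlitz α s (2 * 0)) = 0 := by
    intro m
    rw [altInner_neg_swap]
    induction m with
    | zero => rw [altInner_self, neg_zero]
    | succ m ih =>
      rw [altInner_alSalamCarlitz_even_succ hα hs0 hs1, ← mul_neg, ih, mul_zero]
  induction n with
  | zero => exact h0 m
  | succ n ih => rw [altInner_alSalamCarlitz_even_succ hα hs0 hs1, ih, mul_zero]

lemma qPochInf_ne_zero {a : ℝ} (hs0 : 0 < s) (hs1 : s < 1) (ha : a < 1) : qPochInf a s ≠ 0 := by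
  have := tprod_one_add_ne_zero_of_summable (f := fun k : ℕ => -a * s ^ k) (fun k => ?_)
    (summable_mul_geometric (-a) hs0 hs1).norm
  · simpa [qPochInf, sub_eq_add_neg] using this
  · have h1 : s ^ k ≤ 1 := pow_le_one₀ hs0.le hs1.le
    have h2 := pow_pos hs0 k
    nlinarith

lemma qPoch_ne_zero (hs0 : 0 < s) (hs1 : s < 1) (n : ℕ) : qPoch s s n ≠ 0 := by
  rw [qPoch, Finset.prod_ne_zero_iff]
  intro k _
  have : s ^ (k + 1) < 1 := pow_lt_one₀ hs0.le hs1 (by omega)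
  rw [pow_succ'] at this
  linarith

/-- Negativity of `α` puts both `α` and `α⁻¹ * s` below `1`, so no factor of the infinite products
vanishes. -/
lemma altNorm_ne_zero (hα : α < 0) (hs0 : 0 < s) (hs1 : s < 1) (m : ℕ) : altNorm α s m ≠ 0 := by
  have h1 : (1 - s ^ 2) ≠ 0 := by have := sq_lt_one_of_base hs0 hs1; linarith
  have h2 : α⁻¹ * s < 1 := by
    have := mul_neg_of_neg_of_pos (inv_lt_zero.2 hα) hs0
    linarith
  have h3 := qPochInf_ne_zero hs0 hs1 (hα.trans one_pos)
  have h4 := qPochInf_ne_zero hs0 hs1 h2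
  have h5 := qPochInf_ne_zero hs0 hs1 hs1
  have h6 := qPoch_ne_zero hs0 hs1 (2 * m)
  have h7 : -α ≠ 0 := by linarith
  unfold altNorm
  positivity

end

/-! ### Skew orthogonal polynomials -/

lemma exists_eq_sum_of_mem_degreeLT {P : ℕ → Polynomial ℝ} (hm : ∀ n, (P n).Monic)
    (hd : ∀ n, (P n).natDegree = n) (N : ℕ) {v : Polynomial ℝ}
    (hv : v ∈ Polynomial.degreeLT ℝ N) :
    ∃ c : ℕ → ℝ, v = ∑ k ∈ Finset.range N, c k • P k := by
  induction N generalizing v with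
  | zero =>
    refine ⟨0, ?_⟩
    simpa [Polynomial.mem_degreeLT, Polynomial.degree_lt_iff_coeff_zero, Polynomial.ext_iff]
      using hv
  | succ N ih =>
    have hw : v - v.coeff N • P N ∈ Polynomial.degreeLT ℝ N := by
      rw [Polynomial.mem_degreeLT, Polynomial.degree_lt_iff_coeff_zero] at hv ⊢
      intro k hk
      rcases hk.eq_or_lt with rfl | hk
      · have h1 : (P N).coeff N = 1 := by
          have := (hm N).coeff_natDegree
          rwa [hd] at this
        simp [h1]
      · have h0 : (P N).coeff k = 0 :=
          Polynomial.coeff_eq_zero_of_natDegree_lt (by rwa [hd])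
        simp [h0, hv k hk]
    obtain ⟨c, hc⟩ := ih hw
    refine ⟨fun k => if k = N then v.coeff N else c k, ?_⟩
    simp only [Finset.sum_range_succ, if_true]
    rw [← sub_eq_iff_eq_add, hc]
    refine Finset.sum_congr rfl fun k hk => ?_
    rw [if_neg (Finset.mem_range.1 hk).ne]

/-- Nondegeneracy of a skew form on the span of the first members of a skew orthogonal family. -/
lemma eq_zero_of_forall_skew_eq_zero (B : Polynomial ℝ →ₗ[ℝ] Polynomial ℝ →ₗ[ℝ] ℝ)
    (hB : ∀ φ ψ, B φ ψ = -B ψ φ) {P : ℕ → Polynomial ℝ}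
    (hP : IsSkewOrthogonal (fun φ ψ => B φ ψ) P) {N : ℕ} {v : Polynomial ℝ}
    (hv : v ∈ Polynomial.degreeLT ℝ (2 * N)) (h : ∀ k < 2 * N, B v (P k) = 0) : v = 0 := by
  obtain ⟨c, rfl⟩ := exists_eq_sum_of_mem_degreeLT hP.monic hP.natDegree_eq _ hv
  obtain ⟨u, hu, heo⟩ := hP.even_odd
  have hoe : ∀ m n, B (P (2 * m + 1)) (P (2 * n)) = -if n = m then u n else 0 := fun m n => by
    rw [hB, heo]
  have hsum : ∀ j, B (∑ k ∈ Finset.range (2 * N), c k • P k) (P j) =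
      ∑ k ∈ Finset.range (2 * N), c k * B (P k) (P j) := fun j => by
    simp [LinearMap.sum_apply]
  refine Finset.sum_eq_zero fun k hk => ?_
  rw [Finset.mem_range] at hk
  rcases Nat.even_or_odd' k with ⟨m, rfl | rfl⟩
  · have h1 := h (2 * m + 1) (by omega)
    rw [hsum, Finset.sum_eq_single (2 * m), heo, if_pos rfl] at h1
    · rw [(mul_eq_zero.1 h1).resolve_right (hu m), zero_smul]
    · intro b _ hb
      rcases Nat.even_or_odd' b with ⟨l, rfl | rfl⟩
      · rw [heo, if_neg (by rintro rfl; exact hb rfl), mul_zero]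
      · rw [hP.odd_odd, mul_zero]
    · intro h2
      exact absurd (Finset.mem_range.2 hk) h2
  · have h1 := h (2 * m) (by omega)
    rw [hsum, Finset.sum_eq_single (2 * m + 1), hoe, if_pos rfl] at h1
    · rw [(mul_eq_zero.1 h1).resolve_right (neg_ne_zero.2 (hu m)), zero_smul]
    · intro b _ hb
      rcases Nat.even_or_odd' b with ⟨l, rfl | rfl⟩
      · rw [hP.even_even, mul_zero]
      · rw [hoe, if_neg (by rintro rfl; exact hb rfl), neg_zero, mul_zero]
    · intro h2
      exact absurd (Finset.mem_range.2 hk) h2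

/-! ### Characterization of the skew orthogonal family and the inverse relation -/

section

variable {α s : ℝ}

lemma alSalamCarlitz_mem_degreeLT (a s : ℝ) {k N : ℕ} (h : k < N) :
    alSalamCarlitz a s k ∈ Polynomial.degreeLT ℝ N := by
  rw [Polynomial.mem_degreeLT]
  refine Polynomial.degree_le_natDegree.trans_lt ?_
  rw [(alSalamCarlitz_monic_natDegree a s k).2]
  exact_mod_cast h

lemma skewShift_sub_mem_degreeLT (α s : ℝ) (n : ℕ) :
    skewShift α s (2 * n) - alSalamCarlitz α s (2 * n + 1) ∈ Polynomial.degreeLT ℝ (2 * n) := by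
  rw [skewShift, add_sub_cancel_left]
  cases n with
  | zero => simp
  | succ n =>
    rw [← Polynomial.smul_eq_C_mul]
    exact Submodule.smul_mem _ _ (alSalamCarlitz_mem_degreeLT α s (by omega))

lemma skewShift_monic_natDegree (α s : ℝ) (n : ℕ) :
    (skewShift α s (2 * n)).Monic ∧ (skewShift α s (2 * n)).natDegree = 2 * n + 1 := by
  have h := skewShift_sub_mem_degreeLT α s n
  obtain ⟨hm, hd⟩ := alSalamCarlitz_monic_natDegree α s (2 * n + 1)
  rw [Polynomial.mem_degreeLT] at h
  have hlt : (skewShift α s (2 * n) - alSalamCarlitz α s (2 * n + 1)).degree <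
      (alSalamCarlitz α s (2 * n + 1)).degree := by
    rw [Polynomial.degree_eq_natDegree hm.ne_zero, hd]
    exact h.trans (by exact_mod_cast Nat.lt_succ_self _)
  rw [← add_sub_cancel (alSalamCarlitz α s (2 * n + 1)) (skewShift α s (2 * n))]
  exact ⟨hm.add_of_left hlt, by rw [Polynomial.natDegree_add_eq_left_of_degree_lt hlt, hd]⟩

lemma isSkewOrthogonal_of_eq_mul {S T : Polynomial ℝ → Polynomial ℝ → ℝ} {c : ℝ} (hc : c ≠ 0)
    (h : ∀ φ ψ, S φ ψ = c * T φ ψ) {Q : ℕ → Polynomial ℝ} (hQ : IsSkewOrthogonal T Q) :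
    IsSkewOrthogonal S Q where
  monic := hQ.monic
  natDegree_eq := hQ.natDegree_eq
  even_even m n := by rw [h, hQ.even_even, mul_zero]
  odd_odd m n := by rw [h, hQ.odd_odd, mul_zero]
  even_odd := by
    obtain ⟨u, hu, huv⟩ := hQ.even_odd
    refine ⟨fun m => c * u m, fun m => mul_ne_zero hc (hu m), fun m n => ?_⟩
    rw [h, huv]
    split_ifs <;> simp

lemma isSkewOrthogonal_skewInner_iff (hα : α < 0) (hs0 : 0 < s) (hs1 : s < 1)
    {Q : ℕ → Polynomial ℝ} :
    IsSkewOrthogonal (skewInner (s ^ 2) α 1 (skewWeight α (s ^ 2))) Q ↔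
      IsSkewOrthogonal (altInner α s) Q := by
  have hc : (-α)⁻¹ ≠ 0 := inv_ne_zero (by linarith)
  have h := fun φ ψ => skewInner_eq_altInner hα hs0 hs1 φ ψ
  exact ⟨isSkewOrthogonal_of_eq_mul (inv_ne_zero hc) fun φ ψ => by
    rw [h, inv_mul_cancel_left₀ hc], isSkewOrthogonal_of_eq_mul hc h⟩

lemma isSkewOrthogonal_of_eq (hα : α < 0) (hs0 : 0 < s) (hs1 : s < 1)
    {Q : ℕ → Polynomial ℝ} (hQ : ∀ n, Q (2 * n) = alSalamCarlitz α s (2 * n) ∧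
      Q (2 * n + 1) = skewShift α s (2 * n)) :
    IsSkewOrthogonal (altInner α s) Q where
  monic k := by
    rcases Nat.even_or_odd' k with ⟨m, rfl | rfl⟩
    · rw [(hQ m).1]
      exact (alSalamCarlitz_monic_natDegree α s _).1
    · rw [(hQ m).2]
      exact (skewShift_monic_natDegree α s _).1
  natDegree_eq k := by
    rcases Nat.even_or_odd' k with ⟨m, rfl | rfl⟩
    · rw [(hQ m).1]
      exact (alSalamCarlitz_monic_natDegree α s _).2
    · rw [(hQ m).2]
      exact (skewShift_monic_natDegree α s _).2
  even_even m n := by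
    rw [(hQ m).1, (hQ n).1, altInner_alSalamCarlitz_even hα.ne hs0 hs1]
  odd_odd m n := by
    rw [(hQ m).2, (hQ n).2, altInner_skewShift_skewShift hα.ne hs0 hs1]
  even_odd := ⟨altNorm α s, altNorm_ne_zero hα hs0 hs1, fun m n => by
    rw [(hQ m).1, (hQ n).2, altInner_alSalamCarlitz_skewShift hα.ne hs0 hs1]⟩

/-- Strong induction: once the members of index below `2 * n` are known, each of the next two has
the same pairings with them as its candidate, so `eq_zero_of_forall_skew_eq_zero` forces equality.
-/
theorem isSkewOrthogonal_and_oddNormalized_iff (hα : α < 0) (hs0 : 0 < s) (hs1 : s < 1)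
    (Q : ℕ → Polynomial ℝ) :
    (IsSkewOrthogonal (altInner α s) Q ∧ OddNormalized (alSalamCarlitz α s) Q) ↔
      ∀ n, Q (2 * n) = alSalamCarlitz α s (2 * n) ∧ Q (2 * n + 1) = skewShift α s (2 * n) := by
  constructor
  · rintro ⟨hS, hO⟩ n
    obtain ⟨u, -, heo⟩ := hS.even_odd
    have hanti := altInner_neg_swap α s
    have hee := altInner_alSalamCarlitz_even hα.ne hs0 hs1
    have huo := altInner_alSalamCarlitz_skewShift hα.ne hs0 hs1
    have hoo := altInner_skewShift_skewShift hα.ne hs0 hs1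
    induction n using Nat.strong_induction_on with
    | _ n ih =>
      constructor
      · refine sub_eq_zero.1 (eq_zero_of_forall_skew_eq_zero (altForm α hs0 hs1) hanti hS
          (N := n) ?_ fun k hk => ?_)
        · obtain ⟨hm, hd⟩ := alSalamCarlitz_monic_natDegree α s (2 * n)
          have hdeg : (Q (2 * n)).degree = (2 * n : ℕ) := by
            rw [Polynomial.degree_eq_natDegree (hS.monic _).ne_zero, hS.natDegree_eq]
          rw [Polynomial.mem_degreeLT, ← hdeg]
          refine Polynomial.degree_sub_lt_left ?_ (hS.monic _).ne_zero ?_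
          · rw [hdeg, Polynomial.degree_eq_natDegree hm.ne_zero, hd]
          · rw [hm.leadingCoeff, (hS.monic _).leadingCoeff]
        · rw [map_sub, LinearMap.sub_apply, altForm_apply, altForm_apply]
          rcases Nat.even_or_odd' k with ⟨m, rfl | rfl⟩
          · rw [hS.even_even, (ih m (by omega)).1, hee, sub_zero]
          · rw [heo, (ih m (by omega)).2, huo, if_neg (by omega), if_neg (by omega), sub_zero]
      · refine sub_eq_zero.1 (eq_zero_of_forall_skew_eq_zero (altForm α hs0 hs1) hanti hS
          (N := n) ?_ fun k hk => ?_)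
        -- Monicity alone would allow a difference of degree `2 * n`; the normalization excludes the
        -- `U_{2n}` component.
        · have h1 : Q (2 * n + 1) - alSalamCarlitz α s (2 * n + 1) ∈
              Polynomial.degreeLT ℝ (2 * n) := by
            refine Submodule.span_le.2 ?_ (hO n)
            rintro _ ⟨k, hk, rfl⟩
            exact alSalamCarlitz_mem_degreeLT α s hk
          have h2 := Submodule.sub_mem _ h1 (skewShift_sub_mem_degreeLT α s n)
          rwa [sub_sub_sub_cancel_right] at h2
        · rw [map_sub, LinearMap.sub_apply, altForm_apply, altForm_apply]
          rcases Nat.even_or_odd' k with ⟨m, rfl | rfl⟩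
          · rw [hanti, heo, if_neg (by omega), (ih m (by omega)).1, hanti, huo,
              if_neg (by omega), sub_self]
          · rw [hS.odd_odd, (ih m (by omega)).2, hoo, sub_zero]
  · intro hQ
    refine ⟨isSkewOrthogonal_of_eq hα hs0 hs1 hQ, fun n => ?_⟩
    rw [(hQ n).2, skewShift, add_sub_cancel_left]
    cases n with
    | zero => simp
    | succ n =>
      rw [← Polynomial.smul_eq_C_mul]
      exact Submodule.smul_mem _ _ (Submodule.subset_span ⟨_, by simp, rfl⟩)

/-- The coefficients of the inverse relation. -/
noncomputable def inverseCoeff (α s : ℝ) (n j : ℕ) : ℝ :=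
  s ^ ((j + 1 + n) * (n - j)) * (-α) ^ (n - j) * qPoch ((s ^ 2) ^ (j + 1)) (s ^ 2) (n - j)

lemma inverseCoeff_self (α s : ℝ) (n : ℕ) : inverseCoeff α s n n = 1 := by
  simp [inverseCoeff]

lemma inverseCoeff_succ (α s : ℝ) {n j : ℕ} (h : j ≤ n) :
    inverseCoeff α s (n + 1) j =
      -(α * s ^ (2 * (n + 1)) * (1 - s ^ (2 * (n + 1)))) * inverseCoeff α s n j := by
  obtain ⟨d, rfl⟩ := Nat.exists_eq_add_of_le h
  rw [inverseCoeff, inverseCoeff, show j + d + 1 - j = d + 1 by omega,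
    show j + d - j = d by omega, qPoch_succ]
  ring

lemma sum_inverseCoeff_succ (α s : ℝ) (V : ℕ → Polynomial ℝ) (n : ℕ) :
    ∑ j ∈ Finset.range (n + 2), Polynomial.C (inverseCoeff α s (n + 1) j) * V j =
      V (n + 1) - Polynomial.C (α * s ^ (2 * (n + 1)) * (1 - s ^ (2 * (n + 1)))) *
        ∑ j ∈ Finset.range (n + 1), Polynomial.C (inverseCoeff α s n j) * V j := by
  rw [Finset.sum_range_succ, inverseCoeff_self, Finset.mul_sum, map_one, one_mul, add_comm,
    sub_eq_add_neg, ← Finset.sum_neg_distrib]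
  congr 1
  refine Finset.sum_congr rfl fun j hj => ?_
  rw [inverseCoeff_succ α s (by simpa [Nat.lt_succ_iff] using hj)]
  simp only [map_mul, map_neg]
  ring

/-- By `sum_inverseCoeff_succ`, the sum for `n + 1` is its last term minus a multiple of the sum for
`n`, which is the two-term relation solved for `U_{2n+3}`. -/
theorem eq_skewShift_iff_inverse (α s : ℝ) (Q : ℕ → Polynomial ℝ) :
    (∀ n, Q (2 * n) = alSalamCarlitz α s (2 * n) ∧ Q (2 * n + 1) = skewShift α s (2 * n)) ↔
      ∀ n, alSalamCarlitz α s (2 * n) = Q (2 * n) ∧ alSalamCarlitz α s (2 * n + 1) =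
        ∑ j ∈ Finset.range (n + 1), Polynomial.C (inverseCoeff α s n j) * Q (2 * j + 1) := by
  have hidx : ∀ n, 2 * (n + 1) - 1 = 2 * n + 1 := fun n => by omega
  constructor
  · refine fun h n => ⟨(h n).1.symm, ?_⟩
    induction n with
    | zero => simp [(h 0).2, inverseCoeff_self, skewShift]
    | succ n ih =>
      rw [sum_inverseCoeff_succ α s (fun j => Q (2 * j + 1)), ← ih, (h (n + 1)).2, skewShift,
        hidx, add_sub_cancel_right]
  · refine fun h n => ⟨(h n).1.symm, ?_⟩
    rw [skewShift]
    cases n with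
    | zero => simp [(h 0).2, inverseCoeff_self]
    | succ n =>
      rw [hidx, (h n).2, (h (n + 1)).2, sum_inverseCoeff_succ α s (fun j => Q (2 * j + 1)),
        sub_add_cancel]

end

/-! ### Iterated Jackson integrals of alternating functions -/

lemma mul_self_of_anticomm {A : Type*} [Ring A] {b c : A} (hb : b * b = 0) (hbc : b * c = -(c * b)) :
    b * c * (b * c) = 0 := by
  rw [hbc, neg_mul_neg, mul_assoc, ← mul_assoc b c b, hbc, neg_mul, mul_assoc, hb]
  simp

lemma commute_mul_of_anticomm {A : Type*} [Ring A] {e : ℕ → A}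
    (he : ∀ i j, e i * e j = -(e j * e i)) (i j k : ℕ) : Commute (e i) (e j * e k) := by
  rw [Commute, SemiconjBy, ← mul_assoc, he i j, neg_mul, mul_assoc, he i k, mul_neg, neg_neg,
    mul_assoc]

/-! ### Divided powers and weak continuity -/

section

variable {A : Type*} [Ring A] [Algebra ℝ A]

/-- The divided power `a ^ n / n!`. -/
noncomputable def divPow (a : A) (n : ℕ) : A := ((n.factorial : ℝ)⁻¹) • a ^ n

@[simp] lemma divPow_zero (a : A) : divPow a 0 = 1 := by simp [divPow]

lemma divPow_zero_left {n : ℕ} (hn : n ≠ 0) : divPow (0 : A) n = 0 := by simp [divPow, hn]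

lemma commute_divPow_right {a b : A} (h : Commute a b) (n : ℕ) : Commute a (divPow b n) :=
  (h.pow_right n).smul_right _

lemma add_pow_succ_of_mul_self_eq_zero {a b : A} (h : Commute a b) (hb : b * b = 0) (n : ℕ) :
    (a + b) ^ (n + 1) = a ^ (n + 1) + ((n + 1 : ℕ) : ℝ) • (a ^ n * b) := by
  induction n with
  | zero => simp
  | succ n ih =>
    have h1 : a ^ n * b * b = 0 := by rw [mul_assoc, hb, mul_zero]
    have h2 : a ^ n * b * a = a ^ (n + 1) * b := by
      rw [mul_assoc, ← h.eq, ← mul_assoc, ← pow_succ]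
    rw [pow_succ, ih, add_mul, mul_add, mul_add, smul_mul_assoc, smul_mul_assoc, h1, h2,
      smul_zero, add_zero, ← pow_succ, add_assoc]
    congr 1
    push_cast
    module

/-- The binomial expansion stops at first order, and the factorial absorbs its coefficient.
Increments of the two-form are products of one-forms, hence of square zero. -/
lemma divPow_add_of_mul_self_eq_zero {a b : A} (h : Commute a b) (hb : b * b = 0) (n : ℕ) :
    divPow (a + b) (n + 1) = divPow a (n + 1) + divPow a n * b := by
  rw [divPow, add_pow_succ_of_mul_self_eq_zero h hb, smul_add, divPow, divPow, smul_smul,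
    smul_mul_assoc]
  congr 2
  rw [Nat.factorial_succ, Nat.cast_mul]
  have : ((n + 1 : ℕ) : ℝ) ≠ 0 := by positivity
  field_simp

/-- Continuity of an algebra-valued function, tested against linear functionals. -/
def WeaklyContinuous (F : ℝ → A) : Prop := ∀ l : A →ₗ[ℝ] ℝ, Continuous fun x => l (F x)

lemma WeaklyContinuous.sub {F G : ℝ → A} (hF : WeaklyContinuous F) (hG : WeaklyContinuous G) :
    WeaklyContinuous fun x => F x - G x := fun l => by
  simpa only [map_sub] using Continuous.fun_sub (hF l) (hG l)

lemma WeaklyContinuous.const (a : A) : WeaklyContinuous fun _ => a := fun _ => continuous_const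

lemma WeaklyContinuous.const_smul {F : ℝ → A} (hF : WeaklyContinuous F) (c : ℝ) :
    WeaklyContinuous fun x => c • F x := fun l => by
  simpa only [map_smul, smul_eq_mul] using Continuous.fun_mul continuous_const (hF l)

lemma WeaklyContinuous.comp_mul {F : ℝ → A} (hF : WeaklyContinuous F) (c : ℝ) :
    WeaklyContinuous fun x => F (c * x) := fun l =>
  (hF l).comp (continuous_const.mul continuous_id)

lemma WeaklyContinuous.sum_smul_mul {ι : Type*} (t : Finset ι) {c : ι → ℝ → ℝ}
    (hc : ∀ i, Continuous (c i)) (a : ι → A) {G : ℝ → A} (hG : WeaklyContinuous G) :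
    WeaklyContinuous fun x => (∑ i ∈ t, c i x • a i) * G x := fun l => by
  have : ∀ x, l ((∑ i ∈ t, c i x • a i) * G x) =
      ∑ i ∈ t, c i x * (l ∘ₗ LinearMap.mulLeft ℝ (a i)) (G x) := fun x => by
    simp [Finset.sum_mul]
  simp only [this]
  exact continuous_finsetSum _ fun i _ => (hc i).mul (hG _)

/-! ### Form-valued integrals and the `q`-de Bruijn formula -/

variable (α s : ℝ) (e : ℕ → A) (f : ℕ → ℝ → ℝ) (N : ℕ)

/-- The form `∑ f_i(x) e_i` of degree one. -/
noncomputable def oneForm (x : ℝ) : A := ∑ i ∈ Finset.range N, f i x • e i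

/-- The primitive of `f_i`. -/
noncomputable def primOne (i : ℕ) (b : ℝ) : ℝ := jackson (s ^ 2) α b (f i)

/-- The double integral of `f_i` and `f_j`. -/
noncomputable def primTwo (i j : ℕ) (b : ℝ) : ℝ :=
  jackson (s ^ 2) α b fun y => f i y * primOne α s f j (s * y)

/-- The form `∑ Ω_{ij}(b) e_i e_j` of double integrals. -/
noncomputable def twoForm (b : ℝ) : A :=
  ∑ p ∈ Finset.range N ×ˢ Finset.range N, primTwo α s f p.1 p.2 b • (e p.1 * e p.2)

/-- The form-valued iterated integral of `n` copies of `oneForm`. -/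
noncomputable def iterForm (n : ℕ) (b : ℝ) : A :=
  if Even n then divPow (twoForm α s e f N b) (n / 2)
  else oneForm e (primOne α s f) N b * divPow (twoForm α s e f N b) (n / 2)

variable {α s e f N}

lemma oneForm_mul_oneForm (g : ℕ → ℝ → ℝ) (x y : ℝ) :
    oneForm e f N x * oneForm e g N y =
      ∑ p ∈ Finset.range N ×ˢ Finset.range N, (f p.1 x * g p.2 y) • (e p.1 * e p.2) := by
  simp only [oneForm, Finset.sum_mul_sum, smul_mul_smul_comm, Finset.sum_product]

lemma oneForm_anticomm (he : ∀ i j, e i * e j = -(e j * e i)) (g : ℕ → ℝ → ℝ) (x y : ℝ) :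
    oneForm e f N x * oneForm e g N y = -(oneForm e g N y * oneForm e f N x) := by
  simp only [oneForm, Finset.sum_mul_sum, smul_mul_smul_comm, ← Finset.sum_neg_distrib]
  rw [Finset.sum_comm]
  refine Finset.sum_congr rfl fun i _ => Finset.sum_congr rfl fun j _ => ?_
  rw [he, smul_neg, mul_comm]

lemma oneForm_mul_self (he : ∀ i j, e i * e j = -(e j * e i)) (x : ℝ) :
    oneForm e f N x * oneForm e f N x = 0 := by
  have h := oneForm_anticomm he f x x (f := f) (N := N)
  rw [eq_neg_iff_add_eq_zero, ← two_smul ℝ] at h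
  exact (smul_eq_zero.1 h).resolve_left two_ne_zero

lemma commute_twoForm (he : ∀ i j, e i * e j = -(e j * e i)) (i : ℕ) (b : ℝ) :
    Commute (e i) (twoForm α s e f N b) :=
  Commute.sum_right _ _ _ fun _ _ => (commute_mul_of_anticomm he i _ _).smul_right _

lemma commute_oneForm_twoForm (he : ∀ i j, e i * e j = -(e j * e i)) (g : ℕ → ℝ → ℝ)
    (x b : ℝ) : Commute (oneForm e g N x) (twoForm α s e f N b) :=
  Commute.sum_left _ _ _ fun i _ => (commute_twoForm he i b).smul_left _

lemma continuous_primOne (hs0 : 0 < s) (hs1 : s < 1) (hf : ∀ i, Continuous (f i)) (i : ℕ) :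
    Continuous (primOne α s f i) :=
  continuous_jackson (sq_pos_of_base hs0) (sq_lt_one_of_base hs0 hs1) (hf i) α

lemma continuous_mul_primOne (hs0 : 0 < s) (hs1 : s < 1) (hf : ∀ i, Continuous (f i)) (i j : ℕ) :
    Continuous fun y => f i y * primOne α s f j (s * y) := by
  have h1 := hf i
  have h2 := continuous_primOne (α := α) hs0 hs1 hf j
  fun_prop

lemma continuous_primTwo (hs0 : 0 < s) (hs1 : s < 1) (hf : ∀ i, Continuous (f i)) (i j : ℕ) :
    Continuous (primTwo α s f i j) :=
  continuous_jackson (sq_pos_of_base hs0) (sq_lt_one_of_base hs0 hs1)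
    (continuous_mul_primOne hs0 hs1 hf i j) α

lemma weaklyContinuous_oneForm_mul (hs0 : 0 < s) (hs1 : s < 1) (hf : ∀ i, Continuous (f i))
    {G : ℝ → A} (hG : WeaklyContinuous G) :
    WeaklyContinuous fun b => oneForm e (primOne α s f) N b * G b :=
  WeaklyContinuous.sum_smul_mul _ (fun i => continuous_primOne hs0 hs1 hf i) _ hG

lemma weaklyContinuous_twoForm_mul (hs0 : 0 < s) (hs1 : s < 1) (hf : ∀ i, Continuous (f i))
    {G : ℝ → A} (hG : WeaklyContinuous G) :
    WeaklyContinuous fun b => twoForm α s e f N b * G b :=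
  WeaklyContinuous.sum_smul_mul _ (fun p : ℕ × ℕ => continuous_primTwo hs0 hs1 hf p.1 p.2) _ hG

lemma weaklyContinuous_oneForm (hs0 : 0 < s) (hs1 : s < 1) (hf : ∀ i, Continuous (f i)) :
    WeaklyContinuous fun b => oneForm e (primOne α s f) N b := by
  simpa using weaklyContinuous_oneForm_mul (e := e) (N := N) (α := α) hs0 hs1 hf
    (WeaklyContinuous.const (1 : A))

lemma weaklyContinuous_divPow_twoForm (hs0 : 0 < s) (hs1 : s < 1) (hf : ∀ i, Continuous (f i))
    (n : ℕ) : WeaklyContinuous fun b => divPow (twoForm α s e f N b) n := by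
  refine WeaklyContinuous.const_smul ?_ _
  induction n with
  | zero => simpa using WeaklyContinuous.const (1 : A)
  | succ n ih =>
    simp only [pow_succ']
    exact weaklyContinuous_twoForm_mul hs0 hs1 hf ih

lemma weaklyContinuous_iterForm (hs0 : 0 < s) (hs1 : s < 1) (hf : ∀ i, Continuous (f i))
    (n : ℕ) : WeaklyContinuous fun b => iterForm α s e f N n b := by
  have h := weaklyContinuous_divPow_twoForm (e := e) (N := N) (α := α) hs0 hs1 hf (n / 2)
  unfold iterForm
  split_ifs
  · exact h
  · exact weaklyContinuous_oneForm_mul hs0 hs1 hf h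

lemma oneForm_primOne_eq (hs0 : 0 < s) (hs1 : s < 1) (hf : ∀ i, Continuous (f i)) (b : ℝ) :
    oneForm e (primOne α s f) N b =
      oneForm e (primOne α s f) N (s ^ 2 * b) + ((1 - s ^ 2) * b) • oneForm e f N b := by
  simp only [oneForm, Finset.smul_sum, ← Finset.sum_add_distrib, smul_smul, ← add_smul]
  refine Finset.sum_congr rfl fun i _ => ?_
  have := jackson_sub_jackson_mul (sq_pos_of_base hs0) (sq_lt_one_of_base hs0 hs1) (hf i) α b
  congr 1
  simp only [primOne]
  linarith

lemma twoForm_eq (hs0 : 0 < s) (hs1 : s < 1) (hf : ∀ i, Continuous (f i)) (b : ℝ) :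
    twoForm α s e f N b = twoForm α s e f N (s ^ 2 * b) +
      (((1 - s ^ 2) * b) • oneForm e f N b) * oneForm e (primOne α s f) N (s * b) := by
  rw [smul_mul_assoc, oneForm_mul_oneForm]
  simp only [twoForm, Finset.smul_sum, ← Finset.sum_add_distrib, smul_smul, ← add_smul]
  refine Finset.sum_congr rfl fun p _ => ?_
  have := jackson_sub_jackson_mul (sq_pos_of_base hs0) (sq_lt_one_of_base hs0 hs1)
    (continuous_mul_primOne (α := α) hs0 hs1 hf p.1 p.2) α b
  congr 1
  simp only [primTwo]
  linarith

/-- Compares the two-form on the interleaved lattices `y * s ^ (2 * k)` and `s * y * s ^ (2 * k)`.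
The difference of the two sides is continuous, unchanged under `y ↦ s ^ 2 * y`, and zero at `0`
because a one-form squares to zero. -/
lemma twoForm_sub_eq_mul (he : ∀ i j, e i * e j = -(e j * e i)) (hs0 : 0 < s) (hs1 : s < 1)
    (hf : ∀ i, Continuous (f i)) (y : ℝ) :
    twoForm α s e f N y = twoForm α s e f N (s * y) +
      oneForm e (primOne α s f) N y * oneForm e (primOne α s f) N (s * y) := by
  set L := oneForm e (primOne α s f) N with hL
  set O := twoForm α s e f N with hO
  have hwL : WeaklyContinuous L := weaklyContinuous_oneForm hs0 hs1 hf
  have hwO : WeaklyContinuous O := by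
    simpa using weaklyContinuous_twoForm_mul (e := e) (N := N) (α := α) hs0 hs1 hf
      (WeaklyContinuous.const (1 : A))
  have hwLL : WeaklyContinuous fun y => L y * L (s * y) :=
    weaklyContinuous_oneForm_mul hs0 hs1 hf (hwL.comp_mul s)
  have hw := (hwO.sub (hwO.comp_mul s)).sub hwLL
  rw [← sub_eq_zero, ← sub_sub, ← Module.forall_dual_apply_eq_zero_iff ℝ]
  intro l
  have h0 : O 0 - O (s * 0) - L 0 * L (s * 0) = 0 := by
    rw [mul_zero, sub_self, hL, oneForm_mul_self he, sub_zero]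
  rw [eq_apply_zero_of_forall_eq_mul (sq_pos_of_base hs0) (sq_lt_one_of_base hs0 hs1) (hw l)
    (fun x => ?_) y]
  · simp only [h0, map_zero]
  congr 1
  have e1 : O x = _ := twoForm_eq hs0 hs1 hf x
  have e2 : O (s * x) = _ := twoForm_eq hs0 hs1 hf (s * x)
  have e3 : L x = _ := oneForm_primOne_eq hs0 hs1 hf x
  have e4 : L (s * x) = _ := oneForm_primOne_eq hs0 hs1 hf (s * x)
  rw [← hL, ← hO] at e1 e2
  rw [← hL] at e3 e4
  have hs : s ^ 2 * (s * x) = s * (s ^ 2 * x) := by ring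
  rw [hs] at e2 e4
  rw [show s * (s * x) = s ^ 2 * x by ring] at e2
  have e5 : (((1 - s ^ 2) * (s * x)) • oneForm e f N (s * x)) * L (s ^ 2 * x) =
      -(L (s ^ 2 * x) * (((1 - s ^ 2) * (s * x)) • oneForm e f N (s * x))) := by
    rw [smul_mul_assoc, mul_smul_comm, oneForm_anticomm he, smul_neg]
  set X := ((1 - s ^ 2) * x) • oneForm e f N x
  set X' := ((1 - s ^ 2) * (s * x)) • oneForm e f N (s * x)
  beta_reduce
  rw [e1, e2, e5, e3, e4]
  noncomm_ring

lemma mul_divPow_add_mul {a b c : A} (hab : Commute b a) (hac : Commute c a) (hb : b * b = 0)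
    (hbc : b * c = -(c * b)) (n : ℕ) : b * divPow (a + b * c) n = b * divPow a n := by
  cases n with
  | zero => simp
  | succ n =>
    rw [divPow_add_of_mul_self_eq_zero (hab.mul_left hac).symm
      (mul_self_of_anticomm hb hbc), mul_add, ← mul_assoc,
      (commute_divPow_right hab n).eq, mul_assoc, ← mul_assoc b, hb, zero_mul, mul_zero, add_zero]

/-- The odd step of `iterForm_succ_sub`: `a` and `m` are the two-form and the primitive one-form at
`s ^ 2 * b`, `l` is the primitive at `s * b`, and `x` is the increment of the primitive. -/
lemma add_mul_divPow_sub {a x l m : A} (hxa : Commute x a) (hla : Commute l a)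
    (hma : Commute m a) (hx : x * x = 0) (hl : l * l = 0) (hxl : x * l = -(l * x))
    (hxm : x * m = -(m * x)) (hlm : l * m = -(m * l)) (n : ℕ) :
    (m + x) * divPow (a + x * l) n - m * divPow a n = x * divPow (a + l * m) n := by
  cases n with
  | zero => simp
  | succ n =>
    rw [divPow_add_of_mul_self_eq_zero (hxa.mul_left hla).symm (mul_self_of_anticomm hx hxl),
      divPow_add_of_mul_self_eq_zero (hla.mul_left hma).symm (mul_self_of_anticomm hl hlm)]
    have h1 : m * (divPow a n * (x * l)) = x * (divPow a n * (l * m)) := by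
      rw [← mul_assoc, (commute_divPow_right hma n).eq, ← mul_assoc x,
        (commute_divPow_right hxa n).eq, mul_assoc, mul_assoc, hlm, mul_neg, ← mul_assoc x m,
        hxm, neg_mul, neg_neg, mul_assoc]
    have h2 : x * (divPow a n * (x * l)) = 0 := by
      rw [← mul_assoc, (commute_divPow_right hxa n).eq, mul_assoc, ← mul_assoc x, hx, zero_mul,
        mul_zero]
    rw [add_mul, mul_add, mul_add, mul_add, h1, h2]
    abel

/-- The difference equation that characterizes the iterated integral. Both two-forms, at `b` and at
`s * b`, are expanded around `s ^ 2 * b`, and anticommutation removes the surplus terms. -/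
lemma iterForm_succ_sub (he : ∀ i j, e i * e j = -(e j * e i)) (hs0 : 0 < s) (hs1 : s < 1)
    (hf : ∀ i, Continuous (f i)) (n : ℕ) (b : ℝ) :
    iterForm α s e f N (n + 1) b - iterForm α s e f N (n + 1) (s ^ 2 * b) =
      ((1 - s ^ 2) * b) • (oneForm e f N b * iterForm α s e f N n (s * b)) := by
  have e1 := twoForm_eq (e := e) (N := N) (α := α) hs0 hs1 hf b
  have e2 := twoForm_sub_eq_mul (N := N) (α := α) he hs0 hs1 hf (s * b)
  have e3 := oneForm_primOne_eq (e := e) (N := N) (α := α) hs0 hs1 hf b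
  rw [show s * (s * b) = s ^ 2 * b by ring] at e2
  have hxl : ∀ g y, (((1 - s ^ 2) * b) • oneForm e f N b) * oneForm e g N y =
      -(oneForm e g N y * (((1 - s ^ 2) * b) • oneForm e f N b)) := fun g y => by
    rw [smul_mul_assoc, mul_smul_comm, oneForm_anticomm he, smul_neg]
  have hx : (((1 - s ^ 2) * b) • oneForm e f N b) * (((1 - s ^ 2) * b) • oneForm e f N b) = 0 := by
    rw [smul_mul_smul_comm, oneForm_mul_self he, smul_zero]
  have hxa : Commute (((1 - s ^ 2) * b) • oneForm e f N b) (twoForm α s e f N (s ^ 2 * b)) :=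
    (commute_oneForm_twoForm he _ _ _).smul_left _
  have hla := commute_oneForm_twoForm (N := N) (α := α) (s := s) (f := f) he (primOne α s f)
    (s * b) (s ^ 2 * b)
  have hma := commute_oneForm_twoForm (N := N) (α := α) (s := s) (f := f) he (primOne α s f)
    (s ^ 2 * b) (s ^ 2 * b)
  have hlm := oneForm_anticomm (N := N) (f := primOne α s f) he (primOne α s f)
    (s * b) (s ^ 2 * b)
  have hl := oneForm_mul_self (N := N) (f := primOne α s f) he (s * b)
  rw [← smul_mul_assoc]
  rcases Nat.even_or_odd' n with ⟨k, rfl | rfl⟩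
  · have h1 : ¬ Even (2 * k + 1) := by simp
    have h2 : (2 * k + 1) / 2 = k := by omega
    have h3 : (2 * k) / 2 = k := by omega
    simp only [iterForm, if_neg h1, h2, h3, if_pos (even_two_mul k)]
    rw [e1, e2, e3]
    exact add_mul_divPow_sub hxa hla hma hx hl (hxl _ _) (hxl _ _) hlm k
  · have h1 : ¬ Even (2 * k + 1) := by simp
    have h2 : (2 * k + 1) / 2 = k := by omega
    have h3 : (2 * k + 1 + 1) / 2 = k + 1 := by omega
    have h4 : Even (2 * k + 1 + 1) := ⟨k + 1, by ring⟩
    simp only [iterForm, if_neg h1, h2, h3, if_pos h4]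
    rw [e1, e2, mul_divPow_add_mul hla hma hl hlm,
      divPow_add_of_mul_self_eq_zero (hxa.mul_left hla).symm (mul_self_of_anticomm hx (hxl _ _)),
      add_sub_cancel_left, ← (commute_divPow_right (hxa.mul_left hla) k).eq, mul_assoc]

lemma iterForm_succ_self (n : ℕ) : iterForm α s e f N (n + 1) α = 0 := by
  have h1 : twoForm α s e f N α = 0 := by simp [twoForm, primTwo, jackson_self]
  have h2 : oneForm e (primOne α s f) N α = 0 := by simp [oneForm, primOne, jackson_self]
  rw [iterForm, h1, h2]
  split_ifs with h
  · exact divPow_zero_left (by rcases h with ⟨k, hk⟩; omega)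
  · rw [zero_mul]

/-- A `q`-analogue of de Bruijn's formula. -/
theorem iteratedJackson_prod_oneForm (he : ∀ i j, e i * e j = -(e j * e i)) (hs0 : 0 < s)
    (hs1 : s < 1) (hf : ∀ i, Continuous (f i)) (n : ℕ) (l : A →ₗ[ℝ] ℝ) (b : ℝ) :
    iteratedJackson (s ^ 2) α n (fun z => l (List.ofFn fun i => oneForm e f N (z i)).prod) b =
      l (iterForm α s e f N n b) := by
  induction n generalizing l b with
  | zero => simp [iteratedJackson, iterForm]
  | succ n ih =>
    have h : ∀ z, iteratedJackson (s ^ 2) α n (fun v => l (List.ofFn fun i =>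
        oneForm e f N ((Fin.cons z v : Fin (n + 1) → ℝ) i)).prod) (Real.sqrt (s ^ 2) * z) =
        l (oneForm e f N z * iterForm α s e f N n (s * z)) := fun z => by
      rw [Real.sqrt_sq hs0.le]
      -- The outermost one-form is absorbed into the functional, which is why the induction runs
      -- over all `l`.
      simpa [List.ofFn_succ] using ih (l ∘ₗ LinearMap.mulLeft ℝ (oneForm e f N z)) (s * z)
    simp only [iteratedJackson, h]
    have hw := weaklyContinuous_iterForm (e := e) (N := N) (α := α) hs0 hs1 hf
    have hg : Continuous fun z => l (oneForm e f N z * iterForm α s e f N n (s * z)) :=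
      WeaklyContinuous.sum_smul_mul _ hf e ((hw n).comp_mul s) l
    rw [jackson_eq_sub (sq_pos_of_base hs0) (sq_lt_one_of_base hs0 hs1) hg
      (G := fun b => l (iterForm α s e f N (n + 1) b)) (hw (n + 1) l),
      iterForm_succ_self, map_zero, sub_zero]
    intro x
    rw [← map_sub, iterForm_succ_sub he hs0 hs1 hf, map_smul, smul_eq_mul, mul_assoc]

end

/-! ### Two-forms built from disjoint pairs -/

lemma sum_range_two_mul {M : Type*} [AddCommMonoid M] (g : ℕ → M) (n : ℕ) :
    ∑ i ∈ Finset.range (2 * n), g i = ∑ m ∈ Finset.range n, (g (2 * m) + g (2 * m + 1)) := by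
  induction n with
  | zero => simp
  | succ n ih =>
    rw [show 2 * (n + 1) = 2 * n + 1 + 1 by ring, Finset.sum_range_succ, Finset.sum_range_succ, ih,
      Finset.sum_range_succ, add_assoc]

section

variable {A : Type*} [Ring A] [Algebra ℝ A] {α s : ℝ} {e : ℕ → A}

lemma mul_self_eq_zero_of_anticomm (he : ∀ i j, e i * e j = -(e j * e i)) (i : ℕ) :
    e i * e i = 0 := by
  have h := he i i
  rw [eq_neg_iff_add_eq_zero, ← two_smul ℝ] at h
  exact (smul_eq_zero.1 h).resolve_left two_ne_zero

/-- A two-form with block-diagonal antisymmetrized coefficients. -/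
lemma sum_smul_mul_eq_of_skew (he : ∀ i j, e i * e j = -(e j * e i)) (W : ℕ → ℕ → ℝ) (u : ℕ → ℝ)
    (hee : ∀ m n, W (2 * n) (2 * m) - W (2 * m) (2 * n) = 0)
    (hoo : ∀ m n, W (2 * n + 1) (2 * m + 1) - W (2 * m + 1) (2 * n + 1) = 0)
    (heo : ∀ m n, W (2 * n + 1) (2 * m) - W (2 * m) (2 * n + 1) = if m = n then u m else 0)
    (n : ℕ) :
    ∑ p ∈ Finset.range (2 * n) ×ˢ Finset.range (2 * n), W p.1 p.2 • (e p.1 * e p.2) =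
      ∑ m ∈ Finset.range n, (-u m) • (e (2 * m) * e (2 * m + 1)) := by
  have h1 : ∑ i ∈ Finset.range (2 * n), ∑ j ∈ Finset.range (2 * n), W i j • (e i * e j) =
      -∑ i ∈ Finset.range (2 * n), ∑ j ∈ Finset.range (2 * n), W j i • (e i * e j) := by
    rw [Finset.sum_comm, ← Finset.sum_neg_distrib]
    refine Finset.sum_congr rfl fun i _ => ?_
    rw [← Finset.sum_neg_distrib]
    refine Finset.sum_congr rfl fun j _ => ?_
    rw [he j i, smul_neg]
  have h2 : (2 : ℝ) • ∑ i ∈ Finset.range (2 * n), ∑ j ∈ Finset.range (2 * n), W i j • (e i * e j) =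
      (2 : ℝ) • ∑ m ∈ Finset.range n, (-u m) • (e (2 * m) * e (2 * m + 1)) := by
    have h3 : (2 : ℝ) • ∑ i ∈ Finset.range (2 * n), ∑ j ∈ Finset.range (2 * n),
        W i j • (e i * e j) = ∑ i ∈ Finset.range (2 * n), ∑ j ∈ Finset.range (2 * n),
          (W i j - W j i) • (e i * e j) := by
      rw [two_smul]
      nth_rw 2 [h1]
      simp only [← sub_eq_add_neg, sub_smul, Finset.sum_sub_distrib]
    rw [h3, sum_range_two_mul, Finset.smul_sum]
    refine Finset.sum_congr rfl fun m hm => ?_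
    rw [sum_range_two_mul, sum_range_two_mul, ← Finset.sum_add_distrib,
      Finset.sum_eq_single m]
    · rw [← neg_sub, hee, ← neg_sub (W (2 * m + 1) (2 * m)), heo, if_pos rfl,
        ← neg_sub (W (2 * m + 1) (2 * m + 1)), hoo, he (2 * m + 1) (2 * m)]
      module
    · intro l _ hl
      rw [← neg_sub, hee, ← neg_sub (W (2 * l + 1) (2 * m)), heo, heo, if_neg hl, if_neg hl.symm,
        ← neg_sub (W (2 * l + 1) (2 * m + 1)), hoo]
      simp
    · exact fun h => absurd hm h
  rw [Finset.sum_product]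
  exact smul_right_injective A (two_ne_zero (α := ℝ)) h2

/-- The pairs commute and square to zero, so the top divided power uses each pair once. The
vanishing of higher powers is what closes the induction. -/
lemma divPow_sum_pairs (he : ∀ i j, e i * e j = -(e j * e i)) (v : ℕ → ℝ) (k : ℕ) :
    divPow (∑ m ∈ Finset.range k, v m • (e (2 * m) * e (2 * m + 1))) k =
        (∏ m ∈ Finset.range k, v m) • ((List.range (2 * k)).map e).prod ∧
      ∀ j, k < j → divPow (∑ m ∈ Finset.range k, v m • (e (2 * m) * e (2 * m + 1))) j = 0 := by
  induction k with
  | zero => simpa using fun j hj => divPow_zero_left (A := A) (Nat.pos_iff_ne_zero.1 hj)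
  | succ k ih =>
    obtain ⟨ih1, ih2⟩ := ih
    have hy : (v k • (e (2 * k) * e (2 * k + 1))) * (v k • (e (2 * k) * e (2 * k + 1))) = 0 := by
      rw [smul_mul_smul_comm,
        mul_self_of_anticomm (mul_self_eq_zero_of_anticomm he _) (he _ _), smul_zero]
    have hc : Commute (∑ m ∈ Finset.range k, v m • (e (2 * m) * e (2 * m + 1)))
        (v k • (e (2 * k) * e (2 * k + 1))) :=
      (Commute.sum_left _ _ _ fun m _ => ((commute_mul_of_anticomm he _ _ _).mul_left
        (commute_mul_of_anticomm he _ _ _)).smul_left _).smul_right _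
    rw [Finset.sum_range_succ]
    constructor
    · rw [divPow_add_of_mul_self_eq_zero hc hy, ih1, ih2 _ (Nat.lt_succ_self k), zero_add,
        smul_mul_smul_comm, Finset.prod_range_succ, show 2 * (k + 1) = 2 * k + 1 + 1 by ring,
        List.range_succ, List.range_succ]
      simp
    · intro j hj
      obtain ⟨j, rfl⟩ : ∃ i, j = i + 1 := ⟨j - 1, by omega⟩
      rw [divPow_add_of_mul_self_eq_zero hc hy, ih2 _ (by omega), ih2 _ (by omega), zero_mul,
        add_zero]

end

/-! ### The exterior algebra and determinants -/

/-- The generators of the exterior algebra of `ℝ^N`. -/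
noncomputable def extGen (N k : ℕ) : ExteriorAlgebra ℝ (Fin N → ℝ) :=
  ExteriorAlgebra.ι ℝ fun j : Fin N => if (j : ℕ) = k then 1 else 0

lemma extGen_anticomm (N i j : ℕ) : extGen N i * extGen N j = -(extGen N j * extGen N i) :=
  eq_neg_of_add_eq_zero_left (ExteriorAlgebra.ι_add_mul_swap _ _)

lemma oneForm_extGen (N : ℕ) (f : ℕ → ℝ → ℝ) (x : ℝ) :
    oneForm (extGen N) f N x = ExteriorAlgebra.ι ℝ fun j : Fin N => f j x := by
  rw [LinearMap.pi_apply_eq_sum_univ (ExteriorAlgebra.ι ℝ), oneForm, Finset.sum_range]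
  simp only [extGen, Fin.ext_iff, eq_comm]

/-- The coefficient of the volume form. -/
noncomputable def extDet (N : ℕ) : ExteriorAlgebra ℝ (Fin N → ℝ) →ₗ[ℝ] ℝ :=
  ExteriorAlgebra.liftAlternating (Function.update 0 N Matrix.detRowAlternating)

lemma extDet_prod (N : ℕ) (v : Fin N → Fin N → ℝ) :
    extDet N (List.ofFn fun i => ExteriorAlgebra.ι ℝ (v i)).prod = (Matrix.of v).det := by
  rw [← ExteriorAlgebra.ιMulti_apply, extDet, ExteriorAlgebra.liftAlternating_apply_ιMulti,
    Function.update_self]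
  rfl

lemma extDet_prod_range (N : ℕ) : extDet N ((List.range N).map (extGen N)).prod = 1 := by
  have h : (List.range N).map (extGen N) = List.ofFn fun i : Fin N => extGen N i := by
    rw [← List.map_coe_finRange_eq_range, List.map_map, List.ofFn_eq_map]
    rfl
  simp only [h, extGen]
  rw [extDet_prod, ← Matrix.det_one (n := Fin N) (R := ℝ)]
  congr 1
  ext i j
  simp [Matrix.one_apply, Fin.ext_iff, eq_comm]

/-- Passing from monomials to monic polynomials leaves the determinant unchanged. Reversing all `n *
(2 * n - 1)` differences gives the sign `(-1) ^ n`, as `2 * n - 1` is odd for `n > 0`. -/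
lemma prod_sub_eq_det {P : ℕ → Polynomial ℝ} (hm : ∀ n, (P n).Monic)
    (hd : ∀ n, (P n).natDegree = n) (n : ℕ) (z : Fin (2 * n) → ℝ) :
    ∏ j : Fin (2 * n), ∏ k ∈ Finset.Ioi j, (z j - z k) =
      (-1) ^ n * (Matrix.of fun i j : Fin (2 * n) => (P j).eval (z i)).det := by
  rw [← Matrix.det_eval_matrixOfPolynomials_eq_det_vandermonde z (fun j : Fin (2 * n) => P j)
    (fun i => hd i) (fun i => hm i), Matrix.det_vandermonde]
  have h1 : ∏ j : Fin (2 * n), ∏ k ∈ Finset.Ioi j, (z j - z k) =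
      ∏ j : Fin (2 * n), ∏ k ∈ Finset.Ioi j, -1 * (z k - z j) :=
    Finset.prod_congr rfl fun j _ => Finset.prod_congr rfl fun k _ => by ring
  rw [h1]
  simp only [Finset.prod_mul_distrib, Finset.prod_const, Fin.card_Ioi]
  congr 1
  rw [Fin.prod_univ_eq_prod_range (fun i => (-1 : ℝ) ^ (2 * n - 1 - i)) (2 * n),
    Finset.prod_range_reflect (fun i => (-1 : ℝ) ^ i) (2 * n), Finset.prod_pow_eq_pow_sum,
    Finset.sum_range_id, mul_assoc, Nat.mul_div_cancel_left _ two_pos, mul_comm, pow_mul]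
  rcases n with _ | n
  · simp
  · rw [Odd.neg_one_pow ⟨n, by omega⟩]

/-! ### Evaluation of the multiple integral -/

section

variable {α s : ℝ}

/-- The skew orthogonal polynomials. -/
noncomputable def skewFamily (α s : ℝ) (k : ℕ) : Polynomial ℝ :=
  if Even k then alSalamCarlitz α s k else skewShift α s (k - 1)

lemma skewFamily_eq (α s : ℝ) (n : ℕ) : skewFamily α s (2 * n) = alSalamCarlitz α s (2 * n) ∧
    skewFamily α s (2 * n + 1) = skewShift α s (2 * n) := by
  simp [skewFamily]

/-- The sign `(-1) ^ n` of the Vandermonde determinant cancels the `n` minus signs of the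
coefficients `-altNorm α s m` in the two-form. -/
theorem iteratedJackson_eq_prod_altNorm (hα : α < 0) (hs0 : 0 < s) (hs1 : s < 1) (n : ℕ) :
    iteratedJackson (s ^ 2) α (2 * n) (fun z =>
        (∏ j : Fin (2 * n), ∏ k ∈ Finset.Ioi j, (z j - z k)) *
          ∏ i : Fin (2 * n), rho α (s ^ 2) (z i)) 1 =
      ∏ m ∈ Finset.range n, altNorm α s m := by
  have hQ := skewFamily_eq α s
  have hS := isSkewOrthogonal_of_eq hα hs0 hs1 hQ
  set f : ℕ → ℝ → ℝ := fun i x => (skewFamily α s i).eval x * rho α (s ^ 2) x with hf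
  have hfc : ∀ i, Continuous (f i) := fun i => continuous_eval_mul_rho hs0 hs1 _
  have hint : ∀ z : Fin (2 * n) → ℝ,
      (∏ j : Fin (2 * n), ∏ k ∈ Finset.Ioi j, (z j - z k)) *
        ∏ i : Fin (2 * n), rho α (s ^ 2) (z i) =
      ((-1 : ℝ) ^ n • extDet (2 * n))
        (List.ofFn fun i => oneForm (extGen (2 * n)) f (2 * n) (z i)).prod := by
    intro z
    simp only [oneForm_extGen]
    rw [LinearMap.smul_apply, extDet_prod, prod_sub_eq_det hS.monic hS.natDegree_eq, smul_eq_mul,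
      mul_assoc, mul_comm (Matrix.det _), ← Matrix.det_mul_column]
    simp only [hf, Matrix.of_apply, mul_comm]
  have htwo : twoForm α s (extGen (2 * n)) f (2 * n) 1 = ∑ m ∈ Finset.range n,
      (-altNorm α s m) • (extGen (2 * n) (2 * m) * extGen (2 * n) (2 * m + 1)) := by
    have hW : ∀ i j, primTwo α s f j i 1 - primTwo α s f i j 1 =
        altInner α s (skewFamily α s i) (skewFamily α s j) := fun i j =>
      (jackson_sub (sq_pos_of_base hs0) (sq_lt_one_of_base hs0 hs1)
        (continuous_mul_primOne hs0 hs1 hfc j i) (continuous_mul_primOne hs0 hs1 hfc i j)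
        α 1).symm
    refine sum_smul_mul_eq_of_skew (extGen_anticomm _) (fun i j => primTwo α s f i j 1)
      (altNorm α s) (fun m n => ?_) (fun m n => ?_) (fun m n => ?_) n
    · rw [hW, hS.even_even]
    · rw [hW, hS.odd_odd]
    · rw [hW, (hQ m).1, (hQ n).2, altInner_alSalamCarlitz_skewShift hα.ne hs0 hs1]
  simp only [hint]
  rw [iteratedJackson_prod_oneForm (extGen_anticomm _) hs0 hs1 hfc, iterForm,
    if_pos (even_two_mul n), Nat.mul_div_cancel_left _ two_pos, htwo,
    (divPow_sum_pairs (extGen_anticomm _) _ n).1, LinearMap.smul_apply, map_smul,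
    extDet_prod_range, smul_eq_mul, smul_eq_mul, mul_one, Finset.prod_neg, Finset.card_range,
    ← mul_assoc, ← mul_pow]
  simp

/-- The exponents `m * (2 * m + 1)` for `m < n` add up to `n * (n - 1) * (4 * n + 1) / 6` in base
`s`, halved in base `s ^ 2`; the odd exponents of `-α` add up to `n ^ 2`. -/
lemma prod_altNorm (α : ℝ) (hs0 : 0 < s) (n : ℕ) :
    ∏ m ∈ Finset.range n, altNorm α s m =
      (-α) ^ (n ^ 2) * (s ^ 2) ^ ((n : ℝ) * ((n : ℝ) - 1) * (4 * (n : ℝ) + 1) / 12) *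
        (1 - s ^ 2) ^ (2 * n) *
        (qPochInf s s * qPochInf α s * qPochInf (α⁻¹ * s) s) ^ n *
        ∏ i ∈ Finset.range n, qPoch s s (2 * i) := by
  induction n with
  | zero => simp
  | succ n ih =>
    have hr : (s ^ 2) ^ (((n + 1 : ℕ) : ℝ) * (((n + 1 : ℕ) : ℝ) - 1) *
        (4 * ((n + 1 : ℕ) : ℝ) + 1) / 12) =
        (s ^ 2) ^ ((n : ℝ) * ((n : ℝ) - 1) * (4 * (n : ℝ) + 1) / 12) * s ^ (n * (2 * n + 1)) := by
      rw [← Real.rpow_natCast s (n * (2 * n + 1)), ← Real.rpow_natCast s 2,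
        ← Real.rpow_mul hs0.le, ← Real.rpow_mul hs0.le, ← Real.rpow_add hs0]
      congr 1
      push_cast
      ring
    rw [Finset.prod_range_succ, ih, hr, Finset.prod_range_succ, altNorm]
    ring

end

end SkewQ

theorem mainTheorem9 (q α : ℝ) (hq0 : 0 < q) (hq1 : q < 1) (hα : α < 0) :
    -- the polynomials `U_n^{(α)}(x;q^{1/2})` are monic and orthogonal
    (∀ n, (SkewQ.alSalamCarlitz α (Real.sqrt q) n).Monic ∧
      (SkewQ.alSalamCarlitz α (Real.sqrt q) n).natDegree = n) ∧
    (∀ m n, SkewQ.jackson (Real.sqrt q) α 1 (fun x =>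
        (SkewQ.alSalamCarlitz α (Real.sqrt q) m).eval x *
          (SkewQ.alSalamCarlitz α (Real.sqrt q) n).eval x * SkewQ.rho α (Real.sqrt q) x) =
      if m = n then
        (-α) ^ n * (1 - Real.sqrt q) * (Real.sqrt q) ^ (n.choose 2) *
          SkewQ.qPoch (Real.sqrt q) (Real.sqrt q) n *
          (SkewQ.qPochInf α (Real.sqrt q) * SkewQ.qPochInf (α⁻¹ * Real.sqrt q) (Real.sqrt q) *
            SkewQ.qPochInf (Real.sqrt q) (Real.sqrt q))
      else 0) ∧
    -- the skew orthogonal polynomials in terms of the orthogonal ones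
    -- (for `n = 0` the coefficient of `U_{2n-1}` vanishes)
    (∀ Q : ℕ → Polynomial ℝ,
      (SkewQ.IsSkewOrthogonal (SkewQ.skewInner q α 1 (SkewQ.skewWeight α q)) Q ∧
        SkewQ.OddNormalized (SkewQ.alSalamCarlitz α (Real.sqrt q)) Q) ↔
      ∀ n, Q (2 * n) = SkewQ.alSalamCarlitz α (Real.sqrt q) (2 * n) ∧
        Q (2 * n + 1) = SkewQ.alSalamCarlitz α (Real.sqrt q) (2 * n + 1) +
          Polynomial.C (α * q ^ n * (1 - q ^ n)) *
            SkewQ.alSalamCarlitz α (Real.sqrt q) (2 * n - 1)) ∧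
    -- the equivalent inverse relation; `(√q)^((j+1+n)(n-j)) = q^{(j+1+n)(n-j)/2}`
    (∀ Q : ℕ → Polynomial ℝ,
      (∀ n, Q (2 * n) = SkewQ.alSalamCarlitz α (Real.sqrt q) (2 * n) ∧
        Q (2 * n + 1) = SkewQ.alSalamCarlitz α (Real.sqrt q) (2 * n + 1) +
          Polynomial.C (α * q ^ n * (1 - q ^ n)) *
            SkewQ.alSalamCarlitz α (Real.sqrt q) (2 * n - 1)) ↔
      ∀ n, SkewQ.alSalamCarlitz α (Real.sqrt q) (2 * n) = Q (2 * n) ∧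
        SkewQ.alSalamCarlitz α (Real.sqrt q) (2 * n + 1) =
          ∑ j ∈ Finset.range (n + 1),
            Polynomial.C ((Real.sqrt q) ^ ((j + 1 + n) * (n - j)) * (-α) ^ (n - j) *
              SkewQ.qPoch (q ^ (j + 1)) q (n - j)) * Q (2 * j + 1)) ∧
    -- the `2n`-fold iterated Jackson integral
    (∀ n : ℕ,
      SkewQ.iteratedJackson q α (2 * n) (fun z =>
        (∏ j : Fin (2 * n), ∏ k ∈ Finset.Ioi j, (z j - z k)) *
          ∏ i : Fin (2 * n), (SkewQ.qPochInf (q * z i) q * SkewQ.qPochInf (q * z i / α) q)) 1 =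
      (-α) ^ (n ^ 2) * q ^ ((n : ℝ) * ((n : ℝ) - 1) * (4 * (n : ℝ) + 1) / 12) *
        (1 - q) ^ (2 * n) *
        (SkewQ.qPochInf (Real.sqrt q) (Real.sqrt q) * SkewQ.qPochInf α (Real.sqrt q) *
          SkewQ.qPochInf (α⁻¹ * Real.sqrt q) (Real.sqrt q)) ^ n *
        ∏ i ∈ Finset.range n, SkewQ.qPoch (Real.sqrt q) (Real.sqrt q) (2 * i)) := by
  -- Taking `s` as the basic parameter turns every half-integer power of `q` in the polynomial
  -- relations into a natural power.
  obtain ⟨s, hs0, hs1, rfl⟩ : ∃ s : ℝ, 0 < s ∧ s < 1 ∧ q = s ^ 2 :=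
    ⟨Real.sqrt q, Real.sqrt_pos.2 hq0, by rwa [Real.sqrt_lt' one_pos, one_pow],
      (Real.sq_sqrt hq0.le).symm⟩
  rw [Real.sqrt_sq hs0.le]
  have hshift : ∀ n, SkewQ.alSalamCarlitz α s (2 * n + 1) +
      Polynomial.C (α * (s ^ 2) ^ n * (1 - (s ^ 2) ^ n)) *
        SkewQ.alSalamCarlitz α s (2 * n - 1) = SkewQ.skewShift α s (2 * n) := fun n => by
    rw [SkewQ.skewShift, ← pow_mul]
  simp only [hshift]
  refine ⟨SkewQ.alSalamCarlitz_monic_natDegree α s, SkewQ.ascInner_alSalamCarlitz hα.ne hs0 hs1,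
    fun Q => ?_, SkewQ.eq_skewShift_iff_inverse α s, fun n => ?_⟩
  · rw [SkewQ.isSkewOrthogonal_skewInner_iff hα hs0 hs1]
    exact SkewQ.isSkewOrthogonal_and_oddNormalized_iff hα hs0 hs1 Q
  · exact (SkewQ.iteratedJackson_eq_prod_altNorm hα hs0 hs1 n).trans
      (SkewQ.prod_altNorm α hs0 n)
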